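/- Let $S^2=\{z\in\mathbb R^3: z_1^2+z_2^2+z_3^2=1\}$, let $\sigma$ be its standard rotation-invariant surface measure, and write $z=(\cos\theta\cos\varphi,\cos\theta\sin\varphi,\sin\theta)$ with latitude $\theta\in[-\pi/2,\pi/2]$. Consider the vector fields $$Z_1=z_3\partial_{z_2}-z_2\partial_{z_3},\quad Z_2=z_1\partial_{z_3}-z_3\partial_{z_1},\quad Z_3=z_2\partial_{z_1}-z_1\partial_{z_2}$$ on $S^2$, and let $\mathcal L=-(Z_1^2+Z_2^2)$ and $T=iZ_3$, regarded as self-adjoint operators on the complex space $L^2(S^2)=L^2(S^2,\sigma)$. Both have pure point spectrum; their powers are defined spectrally, by $\mathcal L^{s}u=\sum_\lambda \lambda^{s}\pi^{\mathcal L}_\lambda u$ and $|T|^{s}u=\sum_\mu|\mu|^{s}\pi^{T}_\mu u$, where $\pi^{\mathcal L}_\lambda$, $\pi^T_\mu$ are the orthogonal projections onto the eigenspaces, with domain the set of $u\in L^2(S^2)$ for which the series converges in $L^2(S^2)$ (for $s<0$, $|T|^s$ is considered on $(\ker T)^\perp$). For $\ell\in\mathbb N=\{0,1,2,\dots\}$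 let $Y_{\ell,0}(z)=\sqrt{\tfrac{2\ell+1}{4\pi}}\,P_\ell(\sin\theta)$ be the zonal spherical harmonic of degree $\ell$, $P_\ell$ being the Legendre polynomial. Let $f\in L^2(S^2)$ be orthogonal to $Y_{\ell,0}$ for all $\ell\in\mathbb N$. Then, for all $\alpha\in[0,1]$, $|T|^{-\alpha}f$ is a well-defined element of $L^2(S^2)$ and $$\int_{S^2}|\tan\theta|^{2\alpha}\,|f|^2\,d\sigma\;\le\;\big\|\mathcal L^{\alpha/2}|T|^{-\alpha}f\big\|_{L^2(S^2)}^2,$$ where the right-hand side is understood as $+\infty$ if $|T|^{-\alpha}f$ is not in the domain of $\mathcal L^{\alpha/2}$. -/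

import Mathlib

open MeasureTheory
open scoped ENNReal ContDiff

noncomputable section

namespace GrushinSphere

/-- The ambient Euclidean space `ℝ³`. -/
abbrev E3 : Type := EuclideanSpace ℝ (Fin 3)

/-- The unit sphere `S²` in `ℝ³`. -/
abbrev S2 : Type := Metric.sphere (0 : E3) 1

/-- The standard rotation-invariant surface measure on `S²` (total mass `4π`). -/
def sigma : Measure S2 := (volume : Measure E3).toSphere

instance : IsFiniteMeasure sigma :=
  inferInstanceAs (IsFiniteMeasure (volume : Measure E3).toSphere)

/-- The complex Hilbert space `L²(S²)`; its inner product `inner ℂ u v` is conjugate-linear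
in `u`. -/
abbrev L2 : Type := Lp ℂ 2 sigma

/-- Smooth complex functions on `S²`, represented by smooth functions on `ℝ³`
(every smooth function on the sphere is the restriction of such a function). -/
structure TestFun where
  /-- the underlying function on `ℝ³` -/
  toFun : E3 → ℂ
  contDiff' : ContDiff ℝ ∞ toFun

/-- The restriction of a continuous function on `ℝ³` to `S²`, as an element of `L²(S²)`. -/
def restrictL2 (g : E3 → ℂ) (hg : Continuous g) : L2 :=
  ContinuousMap.toLp 2 sigma ℂ ⟨fun z : S2 => g z, hg.comp continuous_subtype_val⟩

/-- The restriction of a smooth function to `S²`, as an element of `L²(S²)`. -/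
def TestFun.toL2 (φ : TestFun) : L2 := restrictL2 φ.toFun φ.contDiff'.continuous

/-- The vector fields (with linear coefficients, tangent to `S²`)
`Z₁ = z₃ ∂₂ - z₂ ∂₃`, `Z₂ = z₁ ∂₃ - z₃ ∂₁`, `Z₃ = z₂ ∂₁ - z₁ ∂₂`,
indexed by `0, 1, 2 : Fin 3`. -/
def zField : Fin 3 → E3 → E3
  | 0, z => !₂[0, z 2, -z 1]
  | 1, z => !₂[-z 2, 0, z 0]
  | 2, z => !₂[z 1, -z 0, 0]

theorem contDiff_zField (j : Fin 3) : ContDiff ℝ ∞ (zField j) := by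
  rw [contDiff_euclidean]
  intro i
  fin_cases j <;> fin_cases i <;> simp [zField] <;> fun_prop

/-- The derivative `Z_j φ` of a smooth function along the vector field `Z_j`. -/
def Z (j : Fin 3) (φ : TestFun) : TestFun where
  toFun z := fderiv ℝ φ.toFun z (zField j z)
  contDiff' := (φ.contDiff'.fderiv_right (m := ∞) (by simp)).clm_apply (contDiff_zField j)

/-- The Grushin operator `ℒ φ = -(Z₁² + Z₂²) φ` on smooth functions. -/
def grushin (φ : TestFun) : TestFun where
  toFun z := -((Z 0 (Z 0 φ)).toFun z + (Z 1 (Z 1 φ)).toFun z)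
  contDiff' := ((Z 0 (Z 0 φ)).contDiff'.add (Z 1 (Z 1 φ)).contDiff').neg

/-- The operator `T φ = i Z₃ φ` on smooth functions. -/
def opT (φ : TestFun) : TestFun where
  toFun z := Complex.I * (Z 2 φ).toFun z
  contDiff' := contDiff_const.mul (Z 2 φ).contDiff'

/-- The eigenspace in `L²(S²)`, for the real eigenvalue `lam`, of the self-adjoint realization of a
symmetric differential operator `D` on smooth functions: `u` satisfies `D u = lam u` weakly, that
is, `⟨D φ, u⟩ = lam ⟨φ, u⟩` for every smooth `φ`. -/
def eigenspace (D : TestFun → TestFun) (lam : ℝ) : Submodule ℂ L2 where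
  carrier := {u | ∀ φ : TestFun,
    inner ℂ (D φ).toL2 u = (lam : ℂ) * inner ℂ φ.toL2 u}
  zero_mem' := by intro φ; simp
  add_mem' := by
    intro u v hu hv φ
    rw [inner_add_right, inner_add_right, hu φ, hv φ, mul_add]
  smul_mem' := by
    intro c u hu φ
    rw [inner_smul_right, inner_smul_right, hu φ, mul_left_comm]

theorem isClosed_eigenspace (D : TestFun → TestFun) (lam : ℝ) :
    IsClosed (eigenspace D lam : Set L2) := by
  have h : (eigenspace D lam : Set L2) = ⋂ φ : TestFun, {u : L2 |
      inner ℂ (D φ).toL2 u = (lam : ℂ) * inner ℂ φ.toL2 u} := by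
    ext u
    simp [eigenspace]
  rw [h]
  exact isClosed_iInter fun φ => isClosed_eq (by fun_prop) (by fun_prop)

instance (D : TestFun → TestFun) (lam : ℝ) : CompleteSpace (eigenspace D lam) :=
  (isClosed_eigenspace D lam).completeSpace_coe

/-- The orthogonal projection of `L²(S²)` onto the `lam`-eigenspace of `D`. -/
def eigenProj (D : TestFun → TestFun) (lam : ℝ) : L2 →L[ℂ] L2 :=
  (eigenspace D lam).starProjection

/-- The spectral functional calculus `F(D) u = ∑_lam F(lam) π_lam u` of an operator `D` with pure
point spectrum (as are the Grushin operator and `T`), `π_lam` being the orthogonal projection onto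
the `lam`-eigenspace. It is an unbounded operator whose domain consists of all `u` for which the
series converges (unconditionally) in `L²(S²)`; as the terms are mutually orthogonal, this is the
usual domain `∑_lam |F(lam)|² ‖π_lam u‖² < ∞`. -/
def funCalc (D : TestFun → TestFun) (F : ℝ → ℝ) : L2 →ₗ.[ℂ] L2 where
  domain :=
    { carrier := {u | Summable fun lam : ℝ => (F lam : ℂ) • eigenProj D lam u}
      zero_mem' := by
        change Summable _
        simp
      add_mem' := by
        intro u v hu hv
        change Summable _
        simpa only [map_add, smul_add] using Summable.add hu hv
      smul_mem' := by
        intro c u hu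
        change Summable _
        simpa only [map_smul, smul_comm c] using Summable.const_smul c hu }
  toFun :=
    { toFun := fun u => ∑' lam : ℝ, (F lam : ℂ) • eigenProj D lam (u : L2)
      map_add' := by
        intro u v
        have := Summable.tsum_add u.2 v.2
        simpa only [Submodule.coe_add, map_add, smul_add] using this
      map_smul' := by
        intro c u
        have := Summable.tsum_const_smul c u.2
        simpa only [Submodule.coe_smul, map_smul, smul_comm c, RingHom.id_apply] using this }

/-- The power `ℒ^s` of the (nonnegative, self-adjoint) Grushin operator. -/
def grushinPow (s : ℝ) : L2 →ₗ.[ℂ] L2 := funCalc grushin fun lam => lam ^ s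

/-- The power `|T|^s` of `|T|`. (For `s < 0` it is relevant only on the orthogonal complement of
`ker T`, so the value `0 ^ s` plays no role there.) -/
def absTPow (s : ℝ) : L2 →ₗ.[ℂ] L2 := funCalc opT fun mu => |mu| ^ s

open Classical in
/-- The norm `‖A u‖ ∈ [0, ∞]`, equal to `∞` when `u` is not in the domain of `A`. -/
def extNorm (A : L2 →ₗ.[ℂ] L2) (u : L2) : ℝ≥0∞ :=
  if h : u ∈ A.domain then ‖A ⟨u, h⟩‖ₑ else ⊤

/-- The Legendre polynomial
`P_l(x) = (-1)^l / (2^l l!) (d/dx)^l ((1 - x)^l (1 + x)^l)` (Rodrigues' formula). -/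
def legendreP (l : ℕ) : Polynomial ℝ :=
  Polynomial.C ((-1) ^ l / (2 ^ l * (l.factorial : ℝ))) *
    Polynomial.derivative^[l] ((1 - Polynomial.X) ^ l * (1 + Polynomial.X) ^ l)

/-- The zonal spherical harmonic `Y_{l,0}(z) = √((2l+1)/(4π)) P_l(z₃)` of degree `l`
(where `z₃ = sin θ`), in `L²(S²)`. -/
def zonal (l : ℕ) : L2 :=
  restrictL2
    (fun z => ((Real.sqrt ((2 * (l : ℝ) + 1) / (4 * Real.pi)) * (legendreP l).eval (z 2) : ℝ) : ℂ))
    (by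
      have h : Continuous fun z : E3 => (legendreP l).eval (z 2) :=
        (legendreP l).continuous.comp (by fun_prop)
      fun_prop)

/-- The latitude `θ ∈ [-π/2, π/2]` of `z = (cos θ cos φ, cos θ sin φ, sin θ)`. -/
def latitude (z : S2) : ℝ := Real.arcsin ((z : E3) 2)

end GrushinSphere

end

/-! The fields satisfy `z₁Z₁ + z₂Z₂ + z₃Z₃ = 0`, so Cauchy–Schwarz gives the pointwise bound `tan²θ
|Tu|² ≤ |Z₁u|² + |Z₂u|²`. Integrating by parts on the right yields `∫ tan²θ |Tu|² ≤ ⟨u, ℒu⟩`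
(`wInt_polyT_le`). With `v = Tu` this is the case `α = 1`: `tan²θ ≤ ℒ/T²` as quadratic forms off
`ker T`, where `ℒ/T²` makes sense because `ℒ` and `T` commute.

For `0 < α < 1` the inequality is interpolated, as in the Löwner–Heinz theorem: `x^α` is a positive
superposition over `t > 0` of the functions `tx/(x+t)`, and `tx/(x+t) |c|²` is the minimum of `x|a|²
+ t|b|²` over `a + b = c`. A form inequality passes to these minima (`wInt_resK_le`) and then to the
integral over `t`.

The spectral side is reduced to finite dimensions. Polynomials of degree at most `n`, restricted to
the sphere, are stable under `ℒ` and `T` and so have a joint orthonormal eigenbasis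
(`exists_jointFamily`); by Stone–Weierstrass, `f` is a limit of its projections onto such spaces.
Orthogonality to the zonal harmonics kills the coefficients of `f` along `ker T`. Bessel's
inequality bounds the finite sums by `‖ℒ^(α/2)|T|^(-α)f‖²`, and Fatou's lemma passes to the limit on
the left. -/

namespace GrushinSphere

/-! ### Rotations and invariance of the surface measure -/

/-- The map of `S²` induced by a linear isometry of `ℝ³`. -/
noncomputable def sphereMap (U : E3 ≃ₗᵢ[ℝ] E3) (z : S2) : S2 :=
  ⟨U z, by simp⟩

theorem continuous_sphereMap (U : E3 ≃ₗᵢ[ℝ] E3) : Continuous (sphereMap U) := by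
  unfold sphereMap
  exact Continuous.subtype_mk (U.continuous.comp continuous_subtype_val) _

theorem measurePreserving_sphereMap (U : E3 ≃ₗᵢ[ℝ] E3) :
    MeasurePreserving (sphereMap U) sigma sigma := by
  have hm : Measurable (sphereMap U) := (continuous_sphereMap U).measurable
  refine ⟨hm, ?_⟩
  -- `toSphere` measures a set by the volume of the cone over it, and an isometry carries cones to
  -- cones.
  ext s hs
  rw [Measure.map_apply hm hs, sigma, Measure.toSphere_apply' _ (hm hs),
    Measure.toSphere_apply' _ hs]
  congr 1
  conv_rhs => rw [← U.measurePreserving.measure_preimage_equiv (f := U.toMeasurableEquiv)]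
  congr 1
  ext x
  simp only [Set.mem_smul, Set.mem_image, Set.mem_preimage]
  constructor
  · rintro ⟨r, hr, _, ⟨z, hz, rfl⟩, rfl⟩
    exact ⟨r, hr, _, ⟨sphereMap U z, hz, rfl⟩, (U.map_smul r (z : E3)).symm⟩
  · rintro ⟨r, hr, _, ⟨z, hz, rfl⟩, hx⟩
    have hU : sphereMap U (sphereMap U.symm z) = z := by ext1; simp [sphereMap]
    refine ⟨r, hr, _, ⟨sphereMap U.symm z, by rwa [hU], rfl⟩, U.injective ?_⟩
    rw [U.map_smul]
    exact (congrArg (fun y : S2 => r • (y : E3)) hU).trans hx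

theorem integral_comp_isometry (U : E3 ≃ₗᵢ[ℝ] E3) {g : E3 → ℂ} (hg : Continuous g) :
    ∫ z : S2, g (U z) ∂sigma = ∫ z : S2, g z ∂sigma := by
  have hc : Continuous fun z : S2 => g z := hg.comp continuous_subtype_val
  conv_rhs => rw [← (measurePreserving_sphereMap U).map_eq]
  rw [integral_map (continuous_sphereMap U).aemeasurable hc.aestronglyMeasurable]
  rfl

/-- The rotation of angle `t` generated by the vector field `Z_j` (Rodrigues' formula). -/
noncomputable def rotLin (j : Fin 3) (t : ℝ) : E3 →ₗ[ℝ] E3 where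
  toFun z := z + Real.sin t • zField j z + (1 - Real.cos t) • zField j (zField j z)
  map_add' x y := by
    ext i; fin_cases j <;> fin_cases i <;> simp [zField] <;> ring
  map_smul' c x := by
    ext i; fin_cases j <;> fin_cases i <;> simp [zField] <;> ring

theorem norm_rotLin (j : Fin 3) (t : ℝ) (z : E3) : ‖rotLin j t z‖ = ‖z‖ := by
  have h := Real.sin_sq_add_cos_sq t
  rw [EuclideanSpace.norm_eq, EuclideanSpace.norm_eq]
  congr 1
  simp only [Real.norm_eq_abs, sq_abs, Fin.sum_univ_three]
  fin_cases j <;> simp [rotLin, zField]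
  · linear_combination (z 1 ^ 2 + z 2 ^ 2) * h
  · linear_combination (z 0 ^ 2 + z 2 ^ 2) * h
  · linear_combination (z 0 ^ 2 + z 1 ^ 2) * h

/-- The rotation `rotLin` as a linear isometry equivalence. -/
noncomputable def rot (j : Fin 3) (t : ℝ) : E3 ≃ₗᵢ[ℝ] E3 :=
  LinearIsometry.toLinearIsometryEquiv ⟨rotLin j t, norm_rotLin j t⟩ rfl

theorem rot_apply (j : Fin 3) (t : ℝ) (z : E3) :
    rot j t z = z + Real.sin t • zField j z + (1 - Real.cos t) • zField j (zField j z) := rfl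

theorem rot_zero (j : Fin 3) (z : E3) : rot j 0 z = z := by simp [rot_apply]

theorem hasDerivAt_rot (j : Fin 3) (t : ℝ) (z : E3) :
    HasDerivAt (fun s => rot j s z) (zField j (rot j t z)) t := by
  have h : HasDerivAt (fun s => z + Real.sin s • zField j z +
      (1 - Real.cos s) • zField j (zField j z))
      (Real.cos t • zField j z + Real.sin t • zField j (zField j z)) t := by
    have h1 := ((Real.hasDerivAt_sin t).smul_const (zField j z)).const_add z
    have h2 := ((Real.hasDerivAt_cos t).const_sub 1).smul_const (zField j (zField j z))
    exact (h1.add h2).congr_deriv (by simp)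
  refine HasDerivAt.congr_deriv (f := fun s => rot j s z) h ?_
  rw [rot_apply]
  -- The coordinate identity is `J³ = -J` for the linear map `J = zField j`.
  ext i; fin_cases j <;> fin_cases i <;> simp [zField] <;> ring

/-! ### Integration by parts and symmetry of the operators -/

theorem exists_bound (φ : TestFun) : ∃ C, ∀ z : S2, ‖φ.toFun z‖ ≤ C := by
  obtain ⟨C, hC⟩ := (isCompact_sphere (0 : E3) 1).exists_bound_of_continuousOn
    φ.contDiff'.continuous.continuousOn
  exact ⟨C, fun z => hC z z.2⟩

theorem TestFun.continuous_restrict (φ : TestFun) : Continuous fun z : S2 => φ.toFun z :=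
  φ.contDiff'.continuous.comp continuous_subtype_val

theorem TestFun.integrable (φ : TestFun) : Integrable (fun z : S2 => φ.toFun z) sigma := by
  obtain ⟨C, hC⟩ := exists_bound φ
  exact Integrable.of_bound φ.continuous_restrict.aestronglyMeasurable C (.of_forall hC)

/-- By rotation invariance the integral of `φ ∘ rot j t` does not depend on `t`; its derivative at
`t = 0`, taken under the integral sign, is the integral of `Z_j φ`. -/
theorem integral_Z (j : Fin 3) (φ : TestFun) : ∫ z : S2, (Z j φ).toFun z ∂sigma = 0 := by
  obtain ⟨C, hC⟩ := exists_bound (Z j φ)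
  have hφ : Continuous φ.toFun := φ.contDiff'.continuous
  have hcont (t : ℝ) : Continuous fun z : S2 => φ.toFun (rot j t z) :=
    φ.continuous_restrict.comp (continuous_sphereMap (rot j t))
  have hb (t : ℝ) (z : S2) : ‖(Z j φ).toFun (rot j t z)‖ ≤ C := hC (sphereMap (rot j t) z)
  have h := (hasDerivAt_integral_of_dominated_loc_of_deriv_le (μ := sigma) (x₀ := (0 : ℝ))
    (F := fun t (z : S2) => φ.toFun (rot j t z)) (s := Set.univ)
    (F' := fun t (z : S2) => (Z j φ).toFun (rot j t z)) (bound := fun _ => C)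
    Filter.univ_mem (.of_forall fun t => (hcont t).aestronglyMeasurable)
    (by simpa [rot_zero] using φ.integrable)
    (by simpa [rot_zero] using (Z j φ).integrable.aestronglyMeasurable)
    (.of_forall fun z t _ => hb t z) (integrable_const C)
    (.of_forall fun z t _ => by
      have hd := ((φ.contDiff'.differentiable (by simp)) (rot j t z)).hasFDerivAt
      exact hd.comp_hasDerivAt t (hasDerivAt_rot j t z))).2
  simp only [integral_comp_isometry _ hφ, rot_zero] at h
  exact h.unique (hasDerivAt_const _ _)

theorem inner_restrictL2 {g h : E3 → ℂ} (hg : Continuous g) (hh : Continuous h) :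
    inner ℂ (restrictL2 g hg) (restrictL2 h hh) = ∫ z : S2, h z * (starRingEnd ℂ) (g z) ∂sigma :=
  ContinuousMap.inner_toLp (μ := sigma) _ _

/-- The test function `φ̄ ψ`. -/
noncomputable def TestFun.conjMul (φ ψ : TestFun) : TestFun where
  toFun z := ψ.toFun z * (starRingEnd ℂ) (φ.toFun z)
  contDiff' := ψ.contDiff'.mul (Complex.conjCLE.contDiff.comp φ.contDiff')

theorem inner_Z_left (j : Fin 3) (φ ψ : TestFun) :
    inner ℂ (Z j φ).toL2 ψ.toL2 = -inner ℂ φ.toL2 (Z j ψ).toL2 := by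
  have h := integral_Z j (φ.conjMul ψ)
  have hpt (z : E3) : (Z j (φ.conjMul ψ)).toFun z =
      (φ.conjMul (Z j ψ)).toFun z + ((Z j φ).conjMul ψ).toFun z := by
    have h1 := ((φ.contDiff'.differentiable (by simp)) z).hasFDerivAt
    have h2 := ((ψ.contDiff'.differentiable (by simp)) z).hasFDerivAt
    have h3 := h2.mul (Complex.conjCLE.toContinuousLinearMap.hasFDerivAt.comp z h1)
    have h4 : fderiv ℝ (φ.conjMul ψ).toFun z = _ := h3.fderiv
    simp only [Z, h4]
    simp [TestFun.conjMul, mul_comm, add_comm]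
  simp only [hpt] at h
  rw [integral_add (TestFun.integrable _) (TestFun.integrable _)] at h
  unfold TestFun.toL2
  rw [inner_restrictL2, inner_restrictL2]
  exact eq_neg_of_add_eq_zero_right h

theorem grushin_toL2 (φ : TestFun) :
    (grushin φ).toL2 = -((Z 0 (Z 0 φ)).toL2 + (Z 1 (Z 1 φ)).toL2) := by
  rfl

theorem opT_toL2 (φ : TestFun) : (opT φ).toL2 = Complex.I • (Z 2 φ).toL2 := by
  rfl

theorem inner_grushin_left (φ ψ : TestFun) :
    inner ℂ (grushin φ).toL2 ψ.toL2 = inner ℂ φ.toL2 (grushin ψ).toL2 := by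
  simp only [grushin_toL2, inner_neg_left, inner_neg_right, inner_add_left, inner_add_right,
    inner_Z_left, neg_neg]

theorem inner_grushin_self (φ : TestFun) :
    inner ℂ φ.toL2 (grushin φ).toL2 =
      inner ℂ (Z 0 φ).toL2 (Z 0 φ).toL2 + inner ℂ (Z 1 φ).toL2 (Z 1 φ).toL2 := by
  simp only [grushin_toL2, inner_neg_right, inner_add_right, inner_Z_left, neg_add]

theorem inner_opT_left (φ ψ : TestFun) :
    inner ℂ (opT φ).toL2 ψ.toL2 = inner ℂ φ.toL2 (opT ψ).toL2 := by
  simp [opT_toL2, inner_smul_left, inner_smul_right, inner_Z_left]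

/-! ### Smooth eigenfunctions and the functional calculus -/

/-- `φ` is an eigenfunction, with real eigenvalue `lam`, of `D` in `L²(S²)`. -/
def IsEigenfun (D : TestFun → TestFun) (lam : ℝ) (φ : TestFun) : Prop :=
  (D φ).toL2 = (lam : ℂ) • φ.toL2

/-- `D` is symmetric on smooth functions. -/
def IsSymm (D : TestFun → TestFun) : Prop :=
  ∀ φ ψ : TestFun, inner ℂ (D φ).toL2 ψ.toL2 = inner ℂ φ.toL2 (D ψ).toL2

variable {D : TestFun → TestFun} {lam mu : ℝ}

theorem IsEigenfun.mem_eigenspace (hD : IsSymm D) {φ : TestFun} (h : IsEigenfun D lam φ) :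
    φ.toL2 ∈ eigenspace D lam := by
  intro ψ
  rw [hD, h, inner_smul_right]

theorem IsEigenfun.inner_eq_zero {φ : TestFun} (h : IsEigenfun D lam φ) (hne : mu ≠ lam)
    {u : L2} (hu : u ∈ eigenspace D mu) : inner ℂ φ.toL2 u = 0 := by
  have h1 := hu φ
  rw [h, inner_smul_left, Complex.conj_ofReal] at h1
  have h2 : ((lam : ℂ) - mu) * inner ℂ φ.toL2 u = 0 := by rw [sub_mul, h1, sub_self]
  refine (mul_eq_zero.1 h2).resolve_left fun h3 => hne ?_
  exact_mod_cast (sub_eq_zero.1 h3).symm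

theorem IsEigenfun.eigenProj_self (hD : IsSymm D) {φ : TestFun} (h : IsEigenfun D lam φ) :
    eigenProj D lam φ.toL2 = φ.toL2 :=
  Submodule.starProjection_eq_self_iff.2 (h.mem_eigenspace hD)

theorem IsEigenfun.eigenProj_of_ne {φ : TestFun} (h : IsEigenfun D lam φ) (hne : mu ≠ lam) :
    eigenProj D mu φ.toL2 = 0 := by
  refine Submodule.starProjection_apply_eq_zero_iff _ |>.2 ?_
  rw [Submodule.mem_orthogonal]
  intro u hu
  rw [← inner_conj_symm, h.inner_eq_zero hne hu, map_zero]

theorem inner_eigenProj_left (u v : L2) :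
    inner ℂ (eigenProj D lam u) v = inner ℂ u (eigenProj D lam v) :=
  Submodule.inner_starProjection_left_eq_right _ _ _

/-- The coefficients of `F(D) u` along eigenfunctions of `D`. -/
theorem IsEigenfun.inner_funCalc (hD : IsSymm D) {φ : TestFun} (h : IsEigenfun D lam φ)
    (F : ℝ → ℝ) (u : (funCalc D F).domain) :
    inner ℂ φ.toL2 (funCalc D F u) = (F lam : ℂ) * inner ℂ φ.toL2 (u : L2) := by
  have hs : Summable fun m : ℝ => (F m : ℂ) • eigenProj D m (u : L2) := u.2
  have h1 : funCalc D F u = ∑' m : ℝ, (F m : ℂ) • eigenProj D m (u : L2) := rfl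
  have h2 := (hs.hasSum.mapL (innerSL ℂ φ.toL2)).tsum_eq
  rw [← h1] at h2
  simp only [innerSL_apply_apply] at h2
  rw [← h2, tsum_eq_single lam]
  · rw [inner_smul_right, ← inner_eigenProj_left, h.eigenProj_self hD]
  · intro m hm
    rw [inner_smul_right, ← inner_eigenProj_left, h.eigenProj_of_ne hm, inner_zero_left, mul_zero]

/-! ### The operators on polynomials -/

/-- Polynomials in the three variables `z₁ + i z₂`, `z₁ - i z₂`, `z₃`. -/
abbrev Poly : Type := MvPolynomial (Fin 3) ℂ

/-- The values of the three complex coordinates `z₁ + i z₂`, `z₁ - i z₂`, `z₃`. -/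
noncomputable def coord (z : E3) : Fin 3 → ℂ :=
  ![z 0 + Complex.I * z 1, z 0 - Complex.I * z 1, z 2]

theorem contDiff_coord (i : Fin 3) : ContDiff ℝ ∞ fun z => coord z i := by
  have h (k : Fin 3) : ContDiff ℝ ∞ fun z : E3 => ((z k : ℝ) : ℂ) :=
    Complex.ofRealCLM.contDiff.comp (by fun_prop)
  fin_cases i
  · exact (h 0).add (contDiff_const.mul (h 1))
  · exact (h 0).sub (contDiff_const.mul (h 1))
  · exact h 2

theorem contDiff_eval (p : Poly) : ContDiff ℝ ∞ fun z => MvPolynomial.eval (coord z) p := by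
  induction p using MvPolynomial.induction_on with
  | C a => simpa using contDiff_const
  | add p q hp hq => simpa using hp.add hq
  | mul_X p i hp => simpa using hp.mul (contDiff_coord i)

/-- The test function defined by a polynomial. -/
noncomputable def toTest (p : Poly) : TestFun := ⟨_, contDiff_eval p⟩

theorem toTest_apply (p : Poly) (z : E3) : (toTest p).toFun z = MvPolynomial.eval (coord z) p :=
  rfl

theorem TestFun.ext {φ ψ : TestFun} (h : ∀ z, φ.toFun z = ψ.toFun z) : φ = ψ := by
  cases φ; cases ψ; congr; exact funext h

/-- The values on the variables of the derivation of `Poly` corresponding to `Z_j`. -/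
noncomputable def zGen : Fin 3 → Fin 3 → Poly
  | 0 => ![MvPolynomial.C Complex.I * MvPolynomial.X 2, -(MvPolynomial.C Complex.I * MvPolynomial.X 2),
      MvPolynomial.C (Complex.I / 2) * (MvPolynomial.X 0 - MvPolynomial.X 1)]
  | 1 => ![-MvPolynomial.X 2, -MvPolynomial.X 2,
      MvPolynomial.C (1 / 2) * (MvPolynomial.X 0 + MvPolynomial.X 1)]
  | 2 => ![-(MvPolynomial.C Complex.I * MvPolynomial.X 0), MvPolynomial.C Complex.I * MvPolynomial.X 1, 0]

/-- The derivation of `Poly` corresponding to `Z_j`. -/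
noncomputable def zDer (j : Fin 3) : Derivation ℂ Poly Poly :=
  MvPolynomial.mkDerivation ℂ (zGen j)

theorem fderiv_coord (j i : Fin 3) (z : E3) :
    fderiv ℝ (fun z => coord z i) z (zField j z) = MvPolynomial.eval (coord z) (zGen j i) := by
  have h (k : Fin 3) : HasFDerivAt (fun z : E3 => ((z k : ℝ) : ℂ))
      (Complex.ofRealCLM.comp (EuclideanSpace.proj k : E3 →L[ℝ] ℝ)) z :=
    (Complex.ofRealCLM.comp (EuclideanSpace.proj k : E3 →L[ℝ] ℝ)).hasFDerivAt
  have h0 : fderiv ℝ (fun z => coord z 0) z = _ := ((h 0).add ((h 1).const_mul Complex.I)).fderiv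
  have h1 : fderiv ℝ (fun z => coord z 1) z = _ := ((h 0).sub ((h 1).const_mul Complex.I)).fderiv
  have h2 : fderiv ℝ (fun z => coord z 2) z = _ := (h 2).fderiv
  have hI := Complex.I_mul_I
  fin_cases i
  · rw [Fin.zero_eta, h0]
    fin_cases j <;> simp [zField, zGen, coord] <;> linear_combination (z 1 : ℂ) * hI
  · rw [Fin.mk_one, h1]
    fin_cases j <;> simp [zField, zGen, coord] <;> linear_combination (z 1 : ℂ) * hI
  · change fderiv ℝ (fun z => coord z 2) z _ = _
    rw [h2]
    fin_cases j <;> simp [zField, zGen, coord]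
    · linear_combination (-z 1 : ℂ) * hI
    · ring

/-- Both sides obey the Leibniz rule, so agreement on the three coordinates suffices. -/
theorem Z_toTest (j : Fin 3) (p : Poly) : Z j (toTest p) = toTest (zDer j p) := by
  refine TestFun.ext fun z => ?_
  change fderiv ℝ (fun z => MvPolynomial.eval (coord z) p) z (zField j z) =
    MvPolynomial.eval (coord z) (zDer j p)
  have hdiff (q : Poly) : DifferentiableAt ℝ (fun z => MvPolynomial.eval (coord z) q) z :=
    (contDiff_eval q).differentiable (by simp) z
  induction p using MvPolynomial.induction_on with
  | C a => simp [MvPolynomial.derivation_C]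
  | add p q hp hq =>
    simp only [map_add]
    rw [fderiv_fun_add (hdiff p) (hdiff q), ← hp, ← hq]
    rfl
  | mul_X p i hp =>
    have hX : DifferentiableAt ℝ (fun z => coord z i) z :=
      (contDiff_coord i).differentiable (by simp) z
    simp only [map_mul, MvPolynomial.eval_X, Derivation.leibniz, smul_eq_mul, map_add]
    rw [fderiv_fun_mul (hdiff p) hX, ← hp, zDer, MvPolynomial.mkDerivation_X, ← fderiv_coord]
    rfl

/-- The restriction of polynomials to `S²`, as elements of `L²(S²)`. -/
noncomputable def rho : Poly →ₗ[ℂ] L2 where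
  toFun p := (toTest p).toL2
  map_add' p q := by
    have h : toTest (p + q) = ⟨_, (toTest p).contDiff'.add (toTest q).contDiff'⟩ :=
      TestFun.ext fun z => by simp [toTest_apply]
    rw [h]; rfl
  map_smul' c p := by
    have h : toTest (c • p) = ⟨fun z => c * (toTest p).toFun z, contDiff_const.mul (toTest p).contDiff'⟩ :=
      TestFun.ext fun z => by simp [toTest_apply]
    rw [h]; rfl

theorem rho_apply (p : Poly) : rho p = (toTest p).toL2 := rfl

/-- The Grushin operator on polynomials. -/
noncomputable def polyL : Poly →ₗ[ℂ] Poly :=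
  -((zDer 0).toLinearMap ∘ₗ (zDer 0).toLinearMap + (zDer 1).toLinearMap ∘ₗ (zDer 1).toLinearMap)

/-- The operator `T` on polynomials. -/
noncomputable def polyT : Poly →ₗ[ℂ] Poly := Complex.I • (zDer 2).toLinearMap

theorem polyL_apply (p : Poly) : polyL p = -(zDer 0 (zDer 0 p) + zDer 1 (zDer 1 p)) := rfl

theorem polyT_apply (p : Poly) : polyT p = Complex.I • zDer 2 p := rfl

theorem grushin_toTest (p : Poly) : grushin (toTest p) = toTest (polyL p) := by
  refine TestFun.ext fun z => ?_
  simp only [grushin, Z_toTest, toTest_apply, polyL_apply, map_neg, map_add]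

theorem opT_toTest (p : Poly) : opT (toTest p) = toTest (polyT p) := by
  refine TestFun.ext fun z => ?_
  simp only [opT, Z_toTest, toTest_apply, polyT_apply, MvPolynomial.smul_eval]

theorem C_I_mul_C_I : MvPolynomial.C Complex.I * MvPolynomial.C Complex.I = (-1 : Poly) := by
  rw [← map_mul, Complex.I_mul_I, map_neg, map_one]

theorem C_I_div_two : MvPolynomial.C (Complex.I / 2) =
    (MvPolynomial.C Complex.I * MvPolynomial.C (1 / 2) : Poly) := by
  rw [← map_mul]; congr 1; ring

theorem zDer_X (j i : Fin 3) : zDer j (MvPolynomial.X i) = zGen j i :=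
  MvPolynomial.mkDerivation_X _ _ _

theorem lie_zDer_two_zero : ⁅zDer 2, zDer 0⁆ = zDer 1 := by
  refine MvPolynomial.derivation_ext fun i => ?_
  rw [Derivation.commutator_apply]
  fin_cases i <;> simp [zDer_X, zGen, MvPolynomial.derivation_C, -one_div, C_I_div_two]
  · linear_combination MvPolynomial.X 2 * C_I_mul_C_I
  · linear_combination MvPolynomial.X 2 * C_I_mul_C_I
  · linear_combination -MvPolynomial.C (1 / 2) * (MvPolynomial.X 0 + MvPolynomial.X 1) * C_I_mul_C_I

theorem lie_zDer_two_one : ⁅zDer 2, zDer 1⁆ = -zDer 0 := by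
  refine MvPolynomial.derivation_ext fun i => ?_
  rw [Derivation.commutator_apply, Derivation.neg_apply]
  fin_cases i <;> simp [zDer_X, zGen, MvPolynomial.derivation_C, -one_div, C_I_div_two]
  ring

/-- Bracketing with `Z₃` acts on the pair `(Z₁, Z₂)` as an infinitesimal rotation, which leaves `Z₁²
+ Z₂²` invariant. -/
theorem polyL_polyT_comm (p : Poly) : polyL (polyT p) = polyT (polyL p) := by
  have h0 (q : Poly) : zDer 2 (zDer 0 q) = zDer 0 (zDer 2 q) + zDer 1 q := by
    rw [← lie_zDer_two_zero, Derivation.commutator_apply]; ring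
  have h1 (q : Poly) : zDer 2 (zDer 1 q) = zDer 1 (zDer 2 q) - zDer 0 q := by
    rw [sub_eq_add_neg, ← Derivation.neg_apply, ← lie_zDer_two_one, Derivation.commutator_apply]
    ring
  simp only [polyL_apply, polyT_apply, Derivation.map_smul, map_neg, map_add, h0, h1, map_sub,
    ← smul_add, ← smul_neg]
  congr 1
  abel

/-- The polynomial `(z₁ + i z₂)^a (z₁ - i z₂)^b z₃^c`. -/
noncomputable def mono (a b c : ℕ) : Poly :=
  MvPolynomial.X 0 ^ a * MvPolynomial.X 1 ^ b * MvPolynomial.X 2 ^ c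

/-- This is why `z₁ ± i z₂` serve as coordinates: monomials diagonalise `T`, with integer
eigenvalues. -/
theorem polyT_mono (a b c : ℕ) : polyT (mono a b c) = ((a : ℂ) - b) • mono a b c := by
  have h0 : zDer 2 (MvPolynomial.X 0 ^ a) =
      -((a : Poly) * (MvPolynomial.C Complex.I * MvPolynomial.X 0 ^ a)) := by
    rw [Derivation.leibniz_pow, zDer_X]
    cases a <;> simp [zGen, pow_succ]
    exact .inl (by ring)
  have h1 : zDer 2 (MvPolynomial.X 1 ^ b) =
      (b : Poly) * (MvPolynomial.C Complex.I * MvPolynomial.X 1 ^ b) := by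
    rw [Derivation.leibniz_pow, zDer_X]
    cases b <;> simp [zGen, pow_succ]
    exact .inl (by ring)
  have h2 : zDer 2 (MvPolynomial.X 2 ^ c) = 0 := by
    rw [Derivation.leibniz_pow, zDer_X]
    simp [zGen]
  rw [polyT_apply, mono, Derivation.leibniz, Derivation.leibniz, h0, h1, h2,
    MvPolynomial.smul_eq_C_mul, MvPolynomial.smul_eq_C_mul, map_sub, map_natCast, map_natCast]
  simp only [smul_eq_mul, mul_zero, zero_add]
  linear_combination (((b : Poly) - a) * (MvPolynomial.X 0 ^ a * MvPolynomial.X 1 ^ b *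
    MvPolynomial.X 2 ^ c)) * C_I_mul_C_I

theorem mem_span_mono (p : Poly) :
    p ∈ Submodule.span ℂ (Set.range fun s : ℕ × ℕ × ℕ => mono s.1 s.2.1 s.2.2) := by
  rw [MvPolynomial.as_sum p]
  refine Submodule.sum_mem _ fun s _ => ?_
  rw [MvPolynomial.monomial_eq, ← MvPolynomial.smul_eq_C_mul]
  refine Submodule.smul_mem _ _ (Submodule.subset_span ⟨(s 0, s 1, s 2), ?_⟩)
  rw [Finsupp.prod_fintype _ _ (by simp), Fin.prod_univ_three]
  rfl

/-! ### The filtration by degree -/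

/-- Polynomials of degree at most one. -/
noncomputable def affinePoly : Submodule ℂ Poly :=
  Submodule.span ℂ (insert 1 (Set.range MvPolynomial.X))

theorem X_mem_affinePoly (i : Fin 3) : MvPolynomial.X i ∈ affinePoly :=
  Submodule.subset_span (.inr ⟨i, rfl⟩)

theorem zDer_mem_affinePoly (j : Fin 3) {p : Poly} (hp : p ∈ affinePoly) :
    zDer j p ∈ affinePoly := by
  rw [affinePoly] at hp
  induction hp using Submodule.span_induction with
  | zero => simp
  | add p q _ _ hp hq => rw [map_add]; exact add_mem hp hq
  | smul c p _ hp => rw [Derivation.map_smul]; exact Submodule.smul_mem _ _ hp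
  | mem p hp =>
    have hX := X_mem_affinePoly
    have hC (c : ℂ) {q : Poly} (hq : q ∈ affinePoly) : MvPolynomial.C c * q ∈ affinePoly := by
      rw [← MvPolynomial.smul_eq_C_mul]; exact Submodule.smul_mem _ _ hq
    rcases hp with rfl | ⟨i, rfl⟩
    · simp
    rw [zDer_X]
    fin_cases j <;> fin_cases i
    · exact hC _ (hX 2)
    · exact neg_mem (hC _ (hX 2))
    · exact hC _ (sub_mem (hX 0) (hX 1))
    · exact neg_mem (hX 2)
    · exact neg_mem (hX 2)
    · exact hC _ (add_mem (hX 0) (hX 1))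
    · exact neg_mem (hC _ (hX 0))
    · exact hC _ (hX 1)
    · exact zero_mem _

/-- The fields have linear coefficients, so they do not raise the degree; this gives
finite-dimensional invariant spaces. -/
theorem zDer_mem_pow (j : Fin 3) (n : ℕ) {p : Poly} (hp : p ∈ affinePoly ^ n) :
    zDer j p ∈ affinePoly ^ n := by
  induction n generalizing p with
  | zero =>
    rw [pow_zero, Submodule.mem_one] at hp
    obtain ⟨c, rfl⟩ := hp
    simp
  | succ n ih =>
    rw [pow_succ] at hp ⊢
    induction hp using Submodule.mul_induction_on' with
    | mem_mul_mem a ha b hb =>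
      rw [Derivation.leibniz, smul_eq_mul, smul_eq_mul, mul_comm b]
      exact add_mem (Submodule.mul_mem_mul ha (zDer_mem_affinePoly j hb))
        (Submodule.mul_mem_mul (ih ha) hb)
    | add a _ b _ ha hb => rw [map_add]; exact add_mem ha hb

theorem polyL_mem_pow (n : ℕ) {p : Poly} (hp : p ∈ affinePoly ^ n) : polyL p ∈ affinePoly ^ n :=
  neg_mem (add_mem (zDer_mem_pow 0 n (zDer_mem_pow 0 n hp))
    (zDer_mem_pow 1 n (zDer_mem_pow 1 n hp)))

theorem polyT_mem_pow (n : ℕ) {p : Poly} (hp : p ∈ affinePoly ^ n) : polyT p ∈ affinePoly ^ n :=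
  Submodule.smul_mem _ _ (zDer_mem_pow 2 n hp)

theorem exists_mem_pow (p : Poly) : ∃ n, p ∈ affinePoly ^ n := by
  have h1 : (1 : Submodule ℂ Poly) ≤ affinePoly := by
    rw [Submodule.one_le]; exact Submodule.subset_span (.inl rfl)
  induction p using MvPolynomial.induction_on with
  | C a => exact ⟨0, by rw [pow_zero, Submodule.mem_one]; exact ⟨a, rfl⟩⟩
  | add p q hp hq =>
    obtain ⟨m, hm⟩ := hp
    obtain ⟨n, hn⟩ := hq
    exact ⟨max m n, add_mem (pow_le_pow_right₀ h1 (le_max_left m n) hm)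
      (pow_le_pow_right₀ h1 (le_max_right m n) hn)⟩
  | mul_X p i hp =>
    obtain ⟨n, hn⟩ := hp
    exact ⟨n + 1, by rw [pow_succ]; exact Submodule.mul_mem_mul hn (X_mem_affinePoly i)⟩

theorem fg_affinePoly_pow (n : ℕ) : (affinePoly ^ n).FG :=
  Submodule.FG.pow (Submodule.fg_span ((Set.finite_range _).insert 1)) n

/-! ### Density of polynomials (Stone–Weierstrass) -/

/-- Restriction of polynomials to `S²`, as an algebra homomorphism to continuous functions. -/
noncomputable def polyCont : Poly →ₐ[ℂ] C(S2, ℂ) :=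
  MvPolynomial.aeval fun i => ⟨fun z : S2 => coord z i,
    (contDiff_coord i).continuous.comp continuous_subtype_val⟩

theorem polyCont_apply (p : Poly) (z : S2) : polyCont p z = MvPolynomial.eval (coord z) p := by
  induction p using MvPolynomial.induction_on with
  | C a => simp [polyCont]
  | add p q hp hq => simp [hp, hq]
  | mul_X p i hp => rw [map_mul, ContinuousMap.mul_apply, hp]; simp [polyCont]

theorem rho_eq_toLp (p : Poly) : rho p = ContinuousMap.toLp 2 sigma ℂ (polyCont p) := by
  change ContinuousMap.toLp 2 sigma ℂ _ = _
  congr 1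
  ext z
  exact (polyCont_apply p z).symm

theorem star_polyCont_mem (p : Poly) : star (polyCont p) ∈ polyCont.range := by
  induction p using MvPolynomial.induction_on with
  | C a => exact ⟨MvPolynomial.C (star a), by ext; simp [polyCont]⟩
  | add p q hp hq => rw [map_add, star_add]; exact add_mem hp hq
  | mul_X p i hp =>
    rw [map_mul, star_mul]
    refine mul_mem ?_ hp
    -- Conjugation swaps `z₁ + i z₂` with `z₁ - i z₂` and fixes `z₃`.
    refine ⟨MvPolynomial.X (![1, 0, 2] i), ?_⟩
    ext z
    change polyCont (MvPolynomial.X (![1, 0, 2] i)) z = star (polyCont (MvPolynomial.X i) z)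
    rw [polyCont_apply, polyCont_apply, MvPolynomial.eval_X, MvPolynomial.eval_X]
    fin_cases i <;> simp [coord]
    ring

theorem polyCont_separatesPoints : polyCont.range.SeparatesPoints := by
  intro z w hzw
  by_contra! h
  have h' (i : Fin 3) : coord z i = coord w i := by
    have := h _ ⟨_, ⟨MvPolynomial.X i, rfl⟩, rfl⟩
    simpa [polyCont_apply] using this
  have h0 := h' 0
  have h2 := h' 2
  simp only [coord, Matrix.cons_val_zero, Matrix.cons_val] at h0 h2
  have hre := congrArg Complex.re h0
  have him := congrArg Complex.im h0
  simp at hre him h2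
  refine hzw (Subtype.ext ?_)
  ext i
  fin_cases i
  · exact hre
  · exact him
  · exact h2

theorem denseRange_polyCont : DenseRange polyCont := by
  let A : StarSubalgebra ℂ C(S2, ℂ) :=
    { polyCont.range with star_mem' := by rintro _ ⟨p, rfl⟩; exact star_polyCont_mem p }
  have hA := ContinuousMap.starSubalgebra_topologicalClosure_eq_top_of_separatesPoints A
    polyCont_separatesPoints
  intro g
  have : g ∈ A.topologicalClosure := hA ▸ trivial
  exact this

theorem denseRange_rho : DenseRange rho := by
  have h := (ContinuousMap.toLp_denseRange ℂ sigma ℂ (p := 2) (by simp)).comp denseRange_polyCont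
    (ContinuousMap.toLp 2 sigma ℂ).continuous
  convert h using 1
  ext1 p
  exact rho_eq_toLp p

/-! ### The spectrum of `T` and the domain of `|T|^(-α)` -/

theorem isSymm_opT : IsSymm opT := inner_opT_left

theorem isSymm_grushin : IsSymm grushin := inner_grushin_left

theorem isEigenfun_mono (a b c : ℕ) : IsEigenfun opT ((a : ℝ) - b) (toTest (mono a b c)) := by
  rw [IsEigenfun, opT_toTest, ← rho_apply, polyT_mono, map_smul, rho_apply]
  push_cast
  rfl

theorem eq_zero_of_inner_rho {u : L2} (h : ∀ p, inner ℂ (rho p) u = 0) : u = 0 := by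
  have hd : Dense (LinearMap.range rho : Set L2) := denseRange_rho
  refine hd.eq_zero_of_inner_right (𝕜 := ℂ) ?_
  rintro _ ⟨p, rfl⟩
  exact h p

theorem inner_rho_eq_zero {u : L2} (h : ∀ a b c, inner ℂ (rho (mono a b c)) u = 0) (p : Poly) :
    inner ℂ (rho p) u = 0 := by
  induction mem_span_mono p using Submodule.span_induction with
  | mem p hp => obtain ⟨s, rfl⟩ := hp; exact h _ _ _
  | zero => simp
  | add p q _ _ hp hq => rw [map_add, inner_add_left, hp, hq, add_zero]
  | smul c p _ hp => rw [map_smul, inner_smul_left, hp, mul_zero]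

/-- The eigenspaces are defined weakly, so symmetry on smooth functions alone does not make them
orthogonal. Completeness of the monomials does: each projection fixes or kills every monomial. -/
theorem eigenProj_opT_comp {mu nu : ℝ} (hne : mu ≠ nu) (u : L2) :
    eigenProj opT mu (eigenProj opT nu u) = 0 := by
  refine eq_zero_of_inner_rho (inner_rho_eq_zero fun a b c => ?_)
  have hm := isEigenfun_mono a b c
  rw [← inner_eigenProj_left, rho_apply]
  by_cases h : mu = (a : ℝ) - b
  · rw [h, hm.eigenProj_self isSymm_opT, ← inner_eigenProj_left,
      hm.eigenProj_of_ne (h ▸ hne.symm), inner_zero_left]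
  · rw [hm.eigenProj_of_ne h, inner_zero_left]

theorem eigenProj_opT_eq_zero {mu : ℝ} (hmu : ∀ k : ℤ, mu ≠ k) (u : L2) :
    eigenProj opT mu u = 0 := by
  refine eq_zero_of_inner_rho (inner_rho_eq_zero fun a b c => ?_)
  rw [← inner_eigenProj_left, rho_apply, (isEigenfun_mono a b c).eigenProj_of_ne, inner_zero_left]
  simpa using hmu ((a : ℤ) - b)

theorem eigenspace_opT_pairwise :
    Pairwise fun mu nu : ℝ => eigenspace opT mu ⟂ eigenspace opT nu := by
  intro mu nu hne
  rw [Submodule.isOrtho_iff_inner_eq]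
  intro u hu v hv
  have hu' : eigenProj opT mu u = u := Submodule.starProjection_eq_self_iff.2 hu
  have hv' : eigenProj opT nu v = v := Submodule.starProjection_eq_self_iff.2 hv
  rw [← hu', inner_eigenProj_left, ← hv', eigenProj_opT_comp hne, inner_zero_right]

theorem orthogonalFamily_eigenspace_opT :
    OrthogonalFamily ℂ (fun mu : ℝ => eigenspace opT mu)
      fun mu => (eigenspace opT mu).subtypeₗᵢ :=
  OrthogonalFamily.of_pairwise eigenspace_opT_pairwise

theorem eigenProj_mem (D : TestFun → TestFun) (lam : ℝ) (u : L2) :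
    eigenProj D lam u ∈ eigenspace D lam :=
  Submodule.starProjection_apply_mem _ _

/-- Bessel's inequality for an orthogonal family of complete subspaces. -/
theorem summable_norm_sq_eigenProj_opT (u : L2) :
    Summable fun mu : ℝ => ‖eigenProj opT mu u‖ ^ 2 := by
  refine summable_of_sum_le (c := ‖u‖ ^ 2) (fun _ => by positivity) fun s => ?_
  set y : L2 := ∑ mu ∈ s, eigenProj opT mu u with hy
  have h1 : ‖y‖ ^ 2 = ∑ mu ∈ s, ‖eigenProj opT mu u‖ ^ 2 :=
    orthogonalFamily_eigenspace_opT.norm_sum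
      (fun mu => ⟨eigenProj opT mu u, eigenProj_mem _ _ _⟩) s
  have h2 : (inner ℂ u y : ℂ) = ((‖y‖ ^ 2 : ℝ) : ℂ) := by
    rw [h1, hy, inner_sum, Complex.ofReal_sum]
    refine Finset.sum_congr rfl fun mu _ => ?_
    have h3 : eigenProj opT mu (eigenProj opT mu u) = eigenProj opT mu u :=
      Submodule.starProjection_eq_self_iff.2 (eigenProj_mem _ _ _)
    rw [← h3, ← inner_eigenProj_left, inner_self_eq_norm_sq_to_K, h3]
    simp
  have h3 : ‖y‖ ^ 2 ≤ ‖u‖ * ‖y‖ := by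
    have := norm_inner_le_norm (𝕜 := ℂ) u y
    rwa [h2, Complex.norm_real, Real.norm_of_nonneg (by positivity)] at this
  rw [← h1]
  have hu := norm_nonneg u
  have hy := norm_nonneg y
  nlinarith [sq_nonneg (‖u‖ - ‖y‖)]

/-- Nonzero eigenvalues of `T` are integers, so the multiplier `|μ|^(-α)` is at most one on the
spectrum and Bessel's inequality gives convergence. -/
theorem mem_domain_absTPow {α : ℝ} (hα : 0 ≤ α) (f : L2) : f ∈ (absTPow (-α)).domain := by
  change Summable fun mu : ℝ => ((|mu| ^ (-α) : ℝ) : ℂ) • eigenProj opT mu f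
  have h := orthogonalFamily_eigenspace_opT.summable_iff_norm_sq_summable
    fun mu => ((|mu| ^ (-α) : ℝ) : ℂ) • ⟨eigenProj opT mu f, eigenProj_mem _ _ _⟩
  refine h.2 ?_
  refine Summable.of_nonneg_of_le (fun _ => by positivity) (fun mu => ?_)
    (summable_norm_sq_eigenProj_opT f)
  have hle : ‖((|mu| ^ (-α) : ℝ) : ℂ) • eigenProj opT mu f‖ ≤ ‖eigenProj opT mu f‖ := by
    by_cases hmu : ∃ k : ℤ, mu = k
    · obtain ⟨k, rfl⟩ := hmu
      rw [norm_smul, Complex.norm_real, Real.norm_of_nonneg (by positivity)]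
      refine mul_le_of_le_one_left (norm_nonneg _) ?_
      -- At `μ = 0` the value of `0 ^ (-α)` is `1` for `α = 0` and, by convention, `0` for `α > 0`.
      by_cases hk : k = 0
      · rcases hα.eq_or_lt with rfl | hα'
        · simp
        · simp [hk, Real.zero_rpow (neg_ne_zero.2 hα'.ne')]
      · refine Real.rpow_le_one_of_one_le_of_nonpos ?_ (by linarith)
        exact_mod_cast Int.one_le_abs hk
    · push Not at hmu
      simp [eigenProj_opT_eq_zero hmu]
  exact pow_le_pow_left₀ (norm_nonneg _) hle 2

/-! ### Zonal functions and the kernel of `T` -/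

theorem restrictL2_congr {g h : E3 → ℂ} (hg : Continuous g) (hh : Continuous h)
    (hgh : ∀ z : S2, g z = h z) : restrictL2 g hg = restrictL2 h hh := by
  unfold restrictL2
  congr 1
  ext z
  exact hgh z

/-- The function `q(z₃)` on `S²`, as an element of `L²(S²)`. -/
noncomputable def heightPoly : Polynomial ℝ →ₗ[ℝ] L2 where
  toFun q := restrictL2 (fun z => ((q.eval (z 2) : ℝ) : ℂ))
    (Complex.continuous_ofReal.comp (q.continuous.comp (by fun_prop)))
  map_add' p q := by
    have h : Continuous fun z : E3 => ((p.eval (z 2) : ℝ) : ℂ) + ((q.eval (z 2) : ℝ) : ℂ) :=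
      (Complex.continuous_ofReal.comp (p.continuous.comp (by fun_prop))).add
        (Complex.continuous_ofReal.comp (q.continuous.comp (by fun_prop)))
    rw [restrictL2_congr _ h fun z => by simp]
    rfl
  map_smul' c p := by
    have h : Continuous fun z : E3 => (c : ℂ) * ((p.eval (z 2) : ℝ) : ℂ) :=
      continuous_const.mul (Complex.continuous_ofReal.comp (p.continuous.comp (by fun_prop)))
    rw [restrictL2_congr _ h fun z => by simp]
    rfl

theorem heightPoly_apply (q : Polynomial ℝ) :
    heightPoly q = restrictL2 (fun z => ((q.eval (z 2) : ℝ) : ℂ))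
      (Complex.continuous_ofReal.comp (q.continuous.comp (by fun_prop))) := rfl

theorem zonal_eq (l : ℕ) :
    zonal l = Real.sqrt ((2 * (l : ℝ) + 1) / (4 * Real.pi)) • heightPoly (legendreP l) := by
  rw [← map_smul, heightPoly_apply, zonal]
  refine restrictL2_congr _ _ fun z => ?_
  simp

theorem degree_legendreP (l : ℕ) : (legendreP l).degree = l := by
  have h1 : (1 - Polynomial.X : Polynomial ℝ).natDegree = 1 := by compute_degree!
  have h2 : (1 + Polynomial.X : Polynomial ℝ).natDegree = 1 := by compute_degree!
  have n1 : (1 - Polynomial.X : Polynomial ℝ) ≠ 0 := by rintro h; simp [h] at h1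
  have n2 : (1 + Polynomial.X : Polynomial ℝ) ≠ 0 := by rintro h; simp [h] at h2
  set A : Polynomial ℝ := (1 - Polynomial.X) ^ l * (1 + Polynomial.X) ^ l with hA
  have hA0 : A ≠ 0 := mul_ne_zero (pow_ne_zero _ n1) (pow_ne_zero _ n2)
  have hdeg : A.natDegree = l + l := by
    rw [hA, Polynomial.natDegree_mul (pow_ne_zero _ n1) (pow_ne_zero _ n2),
      Polynomial.natDegree_pow, Polynomial.natDegree_pow, h1, h2, mul_one]
  have hcoeff : A.coeff (l + l) ≠ 0 := by
    rw [← hdeg]; exact Polynomial.leadingCoeff_ne_zero.2 hA0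
  have hc : ((-1) ^ l / (2 ^ l * (l.factorial : ℝ))) ≠ 0 := by positivity
  have hD : (Polynomial.derivative^[l] A).coeff l ≠ 0 := by
    rw [Polynomial.coeff_iterate_derivative, nsmul_eq_mul]
    refine mul_ne_zero ?_ hcoeff
    exact_mod_cast (Nat.descFactorial_pos.2 (Nat.le_add_left l l)).ne'
  rw [legendreP, Polynomial.degree_C_mul hc]
  refine le_antisymm ?_ (Polynomial.le_degree_of_ne_zero hD)
  refine Polynomial.degree_le_of_natDegree_le ?_
  refine (Polynomial.natDegree_iterate_derivative A l).trans ?_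
  omega

/-- The Legendre polynomials, one in each degree. -/
noncomputable def legendreSequence : Polynomial.Sequence ℝ := ⟨legendreP, degree_legendreP⟩

/-- Having one member in each degree, the Legendre polynomials span all polynomials in `z₃`. -/
theorem inner_heightPoly_eq_zero {f : L2} (hf : ∀ l : ℕ, inner ℂ (zonal l) f = 0)
    (q : Polynomial ℝ) : inner ℂ (heightPoly q) f = 0 := by
  have hspan := legendreSequence.span fun i =>
    isUnit_iff_ne_zero.2 (Polynomial.leadingCoeff_ne_zero.2 (legendreSequence.ne_zero i))
  have hq : q ∈ Submodule.span ℝ (Set.range legendreSequence) := hspan ▸ trivial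
  induction hq using Submodule.span_induction with
  | mem p hp =>
    obtain ⟨l, rfl⟩ := hp
    have h := hf l
    rw [zonal_eq, inner_smul_left_eq_smul] at h
    refine (smul_eq_zero.1 h).resolve_left ?_
    have := Real.pi_pos
    positivity
  | zero => simp
  | add p q _ _ hp hq => rw [map_add, inner_add_left, hp, hq, add_zero]
  | smul c p _ hp => rw [map_smul, inner_smul_left_eq_smul, hp, smul_zero]

theorem sum_sq_eq_one (z : S2) : (z : E3) 0 ^ 2 + (z : E3) 1 ^ 2 + (z : E3) 2 ^ 2 = 1 := by
  have h : ‖(z : E3)‖ = 1 := by simp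
  rw [EuclideanSpace.norm_eq, Real.sqrt_eq_one] at h
  simpa [Fin.sum_univ_three] using h

/-- On the sphere `(z₁ + i z₂)(z₁ - i z₂) = 1 - z₃²`, so the monomials with `T`-eigenvalue `0` are
functions of `z₃`. -/
theorem rho_mono_diag (a c : ℕ) :
    rho (mono a a c) = heightPoly ((1 - Polynomial.X ^ 2) ^ a * Polynomial.X ^ c) := by
  rw [heightPoly_apply, rho_apply, TestFun.toL2]
  refine restrictL2_congr _ _ fun z => ?_
  have h : (((z : E3) 0 : ℝ) : ℂ) ^ 2 + ((z : E3) 1 : ℂ) ^ 2 + ((z : E3) 2 : ℂ) ^ 2 = 1 := by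
    have h1 := congrArg (fun x : ℝ => (x : ℂ)) (sum_sq_eq_one z)
    push_cast at h1
    exact h1
  simp only [toTest_apply, mono, coord, map_mul, map_pow, MvPolynomial.eval_X, Matrix.cons_val_zero,
    Matrix.cons_val_one, Matrix.cons_val, Polynomial.eval_mul, Polynomial.eval_pow,
    Polynomial.eval_sub, Polynomial.eval_one, Polynomial.eval_X]
  push_cast
  rw [← mul_pow]
  congr 2
  linear_combination h - ((z : E3) 1 : ℂ) ^ 2 * Complex.I_sq

/-- A function orthogonal to the zonal harmonics is orthogonal to the polynomials in `ker T`. -/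
theorem inner_rho_eq_zero_of_polyT {f : L2} (hf : ∀ l : ℕ, inner ℂ (zonal l) f = 0) {p : Poly}
    (hp : rho (polyT p) = 0) : inner ℂ (rho p) f = 0 := by
  have h0 : IsEigenfun opT 0 (toTest p) := by
    rw [IsEigenfun, opT_toTest, ← rho_apply, hp]; simp
  -- The projection onto `ker T` is moved onto `f`, and the result is tested against monomials:
  -- off-diagonal ones are killed by it, diagonal ones depend on `z₃` only.
  rw [rho_apply, ← h0.eigenProj_self isSymm_opT, inner_eigenProj_left]
  refine inner_rho_eq_zero (fun a b c => ?_) p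
  have hm := isEigenfun_mono a b c
  rw [← inner_eigenProj_left, rho_apply]
  by_cases h : a = b
  · subst h
    rw [sub_self] at hm
    rw [hm.eigenProj_self isSymm_opT, ← rho_apply, rho_mono_diag]
    exact inner_heightPoly_eq_zero hf _
  · rw [hm.eigenProj_of_ne, inner_zero_left]
    intro h'
    exact h (by exact_mod_cast (sub_eq_zero.1 h'.symm))

/-! ### Joint eigenbases of `ℒ` and `T` -/

theorem rho_polyL_inner (p q : Poly) :
    inner ℂ (rho (polyL p)) (rho q) = inner ℂ (rho p) (rho (polyL q)) := by
  simp only [rho_apply, ← grushin_toTest, inner_grushin_left]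

theorem rho_polyT_inner (p q : Poly) :
    inner ℂ (rho (polyT p)) (rho q) = inner ℂ (rho p) (rho (polyT q)) := by
  simp only [rho_apply, ← opT_toTest, inner_opT_left]

/-- Restriction to the sphere is not injective; symmetry makes `ℒ` descend to the quotient, since
`‖ℒp‖² = ⟨p, ℒℒp⟩`. -/
theorem rho_polyL_eq_zero {p : Poly} (hp : rho p = 0) : rho (polyL p) = 0 := by
  rw [← inner_self_eq_zero (𝕜 := ℂ), rho_polyL_inner, hp, inner_zero_left]

theorem rho_polyT_eq_zero {p : Poly} (hp : rho p = 0) : rho (polyT p) = 0 := by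
  rw [← inner_self_eq_zero (𝕜 := ℂ), rho_polyT_inner, hp, inner_zero_left]

/-- Two commuting symmetric operators on a finite-dimensional space have a joint orthonormal
eigenbasis. -/
theorem exists_joint_eigenbasis {V : Type} [NormedAddCommGroup V] [InnerProductSpace ℂ V]
    [FiniteDimensional ℂ V] {A B : V →ₗ[ℂ] V} (hA : A.IsSymmetric) (hB : B.IsSymmetric)
    (hAB : ∀ v, A (B v) = B (A v)) :
    ∃ (ι : Type) (_ : Fintype ι) (e : OrthonormalBasis ι ℂ V) (a b : ι → ℝ),
      (∀ i, A (e i) = (a i : ℂ) • e i) ∧ ∀ i, B (e i) = (b i : ℂ) • e i := by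
  classical
  have hinv (mu : ℂ) : ∀ v ∈ Module.End.eigenspace B mu, A v ∈ Module.End.eigenspace B mu := by
    intro v hv
    rw [Module.End.mem_eigenspace_iff] at hv ⊢
    rw [← hAB, hv, map_smul]
  -- `A` preserves each eigenspace of `B` and is diagonalised there; the bases are then collected.
  let e := hB.direct_sum_isInternal.collectedOrthonormalBasis hB.orthogonalFamily_eigenspaces'
    fun mu => (hA.restrict_invariant (hinv mu)).eigenvectorBasis rfl
  have he (i) : e i = ((hA.restrict_invariant (hinv i.1)).eigenvectorBasis rfl i.2 : V) := by
    simp [e, DirectSum.IsInternal.collectedOrthonormalBasis]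
  refine ⟨_, inferInstance, e, fun i => (hA.restrict_invariant (hinv i.1)).eigenvalues rfl i.2,
    fun i => (i.1 : ℂ).re, fun i => ?_, fun i => ?_⟩
  · have h := congrArg Subtype.val
      ((hA.restrict_invariant (hinv i.1)).apply_eigenvectorBasis rfl i.2)
    rw [he]
    exact h
  · have h1 : B (e i) = (i.1 : ℂ) • e i := by
      rw [← Module.End.mem_eigenspace_iff]
      exact hB.direct_sum_isInternal.collectedOrthonormalBasis_mem _ _ i
    have h2 : ((i.1 : ℂ).re : ℂ) = i.1 :=
      Complex.conj_eq_iff_re.1 (hB.conj_eigenvalue_eq_self i.1.2)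
    rw [h1, h2]

/-- The orthonormal family `rho (p i)` consists of joint eigenfunctions of the Grushin operator
(eigenvalues `lam i`) and of `T` (eigenvalues `m i`). -/
structure IsJointFamily {ι : Type} (p : ι → Poly) (lam m : ι → ℝ) : Prop where
  orthonormal : Orthonormal ℂ fun i => rho (p i)
  polyL_eq : ∀ i, rho (polyL (p i)) = (lam i : ℂ) • rho (p i)
  polyT_eq : ∀ i, rho (polyT (p i)) = (m i : ℂ) • rho (p i)

/-- `ℒ` and `T` induce commuting symmetric operators on the finite-dimensional space of restrictions
of polynomials of degree at most `n`. -/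
theorem exists_jointFamily (n : ℕ) : ∃ (ι : Type) (_ : Fintype ι) (p : ι → Poly) (lam m : ι → ℝ),
    IsJointFamily p lam m ∧
      ∀ q ∈ affinePoly ^ n, rho q ∈ Submodule.span ℂ (Set.range fun i => rho (p i)) := by
  set W := affinePoly ^ n with hW
  let r : W →ₗ[ℂ] W.map rho := rho.submoduleMap W
  have hrv (w : W) : (r w : L2) = rho w := rfl
  obtain ⟨s, hs⟩ := r.exists_rightInverse_of_surjective
    (LinearMap.range_eq_top.2 (rho.submoduleMap_surjective W))
  have hs' (v : W.map rho) : rho (s v) = v := by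
    rw [← hrv]; exact congrArg Subtype.val (LinearMap.congr_fun hs v)
  have : FiniteDimensional ℂ (W.map rho) :=
    Module.Finite.iff_fg.2 ((fg_affinePoly_pow n).map rho)
  -- The operators are defined through a linear section `s` of restriction; `hA'` and `hB'` show
  -- independence of the chosen lift.
  let A : W.map rho →ₗ[ℂ] W.map rho := r ∘ₗ polyL.restrict (fun _ => polyL_mem_pow n) ∘ₗ s
  let B : W.map rho →ₗ[ℂ] W.map rho := r ∘ₗ polyT.restrict (fun _ => polyT_mem_pow n) ∘ₗ s
  have hAv (v) : (A v : L2) = rho (polyL (s v)) := rfl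
  have hBv (v) : (B v : L2) = rho (polyT (s v)) := rfl
  have hA' (v : W.map rho) (q : Poly) (hq : rho q = v) : (A v : L2) = rho (polyL q) := by
    rw [hAv, ← sub_eq_zero, ← map_sub, ← map_sub]
    exact rho_polyL_eq_zero (by rw [map_sub, hs', hq, sub_self])
  have hB' (v : W.map rho) (q : Poly) (hq : rho q = v) : (B v : L2) = rho (polyT q) := by
    rw [hBv, ← sub_eq_zero, ← map_sub, ← map_sub]
    exact rho_polyT_eq_zero (by rw [map_sub, hs', hq, sub_self])
  have hA : A.IsSymmetric := fun u v => by
    rw [Submodule.coe_inner, Submodule.coe_inner, hAv, hAv, ← hs' v, rho_polyL_inner, hs']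
  have hB : B.IsSymmetric := fun u v => by
    rw [Submodule.coe_inner, Submodule.coe_inner, hBv, hBv, ← hs' v, rho_polyT_inner, hs']
  obtain ⟨ι, hι, e, a, b, ha, hb⟩ := exists_joint_eigenbasis hA hB fun v => by
    ext1
    rw [hA' (B v) _ (hBv v).symm, hB' (A v) _ (hAv v).symm, polyL_polyT_comm]
  refine ⟨ι, hι, fun i => s (e i), a, b, ⟨?_, fun i => ?_, fun i => ?_⟩, fun q hq => ?_⟩
  · simp only [hs']
    exact e.orthonormal.comp_linearIsometry (W.map rho).subtypeₗᵢ
  · rw [← hAv, ha, hs']; rfl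
  · rw [← hBv, hb, hs']; rfl
  · simp only [hs']
    have h1 : (⟨rho q, Submodule.mem_map_of_mem hq⟩ : W.map rho) ∈
        Submodule.span ℂ (Set.range e) := by
      rw [← e.coe_toBasis, e.toBasis.span_eq]; trivial
    have h2 := Submodule.mem_map_of_mem (f := (W.map rho).subtype) h1
    rw [Submodule.map_span, ← Set.range_comp] at h2
    exact h2

/-- Every element of `L²(S²)` is approximated by its orthogonal projections onto the spans of
finite joint families. -/
theorem exists_jointFamily_approx (f : L2) {ε : ℝ} (hε : 0 < ε) :
    ∃ (ι : Type) (_ : Fintype ι) (p : ι → Poly) (lam m : ι → ℝ), IsJointFamily p lam m ∧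
      ‖f - ∑ i, (inner ℂ (rho (p i)) f : ℂ) • rho (p i)‖ < ε := by
  obtain ⟨q, hq⟩ := denseRange_rho.exists_dist_lt f hε
  obtain ⟨n, hn⟩ := exists_mem_pow q
  obtain ⟨ι, hι, p, lam, m, hp, hspan⟩ := exists_jointFamily n
  refine ⟨ι, hι, p, lam, m, hp, lt_of_le_of_lt ?_ (dist_eq_norm f (rho q) ▸ hq)⟩
  set y : L2 := ∑ i, (inner ℂ (rho (p i)) f : ℂ) • rho (p i) with hy
  have hspan_y : y ∈ Submodule.span ℂ (Set.range fun i => rho (p i)) :=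
    Submodule.sum_mem _ fun i _ => Submodule.smul_mem _ _ (Submodule.subset_span ⟨i, rfl⟩)
  have horth (v : L2) (hv : v ∈ Submodule.span ℂ (Set.range fun i => rho (p i))) :
      inner ℂ v (f - y) = 0 := by
    induction hv using Submodule.span_induction with
    | mem v hv =>
      obtain ⟨i, rfl⟩ := hv
      rw [inner_sub_right, hy, hp.orthonormal.inner_right_fintype, sub_self]
    | zero => simp
    | add u v _ _ hu hv => rw [inner_add_left, hu, hv, add_zero]
    | smul c v _ hv => rw [inner_smul_left, hv, mul_zero]
  -- Pythagoras: the projection `y` is at least as close to `f` as `rho q`.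
  have h := norm_add_sq_eq_norm_sq_add_norm_sq_of_inner_eq_zero (𝕜 := ℂ) _ _
    (horth _ (sub_mem hspan_y (hspan q hn)))
  rw [sub_add_sub_cancel'] at h
  refine abs_le_of_sq_le_sq' ?_ (norm_nonneg _) |>.2
  nlinarith [mul_self_nonneg ‖y - rho q‖]

/-! ### Weighted integrals and the case `α = 1` -/

/-- The weighted integral `∫ w |v|² dσ`. -/
noncomputable def wInt (w : S2 → ℝ) (v : L2) : ℝ≥0∞ :=
  ∫⁻ z, ENNReal.ofReal (w z * ‖v z‖ ^ 2) ∂sigma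

theorem wInt_one (v : L2) : wInt (fun _ => 1) v = ENNReal.ofReal (‖v‖ ^ 2) := by
  have h := eLpNorm_nnreal_pow_eq_lintegral (f := v) (μ := sigma) (p := 2) (by simp)
  rw [ENNReal.ofReal_pow (norm_nonneg _), ofReal_norm, Lp.enorm_def]
  simp only [wInt, one_mul]
  have h2 : ((2 : NNReal) : ℝ) = ((2 : ℕ) : ℝ) := by norm_num
  simp only [h2, ENNReal.rpow_natCast] at h
  refine Eq.trans (lintegral_congr fun z => ?_) h.symm
  rw [ENNReal.ofReal_pow (norm_nonneg _), ofReal_norm]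

theorem measurable_coe (v : L2) : Measurable v := (Lp.stronglyMeasurable v).measurable

theorem measurable_weight {w : S2 → ℝ} (hw : Measurable w) (v : L2) :
    Measurable fun z => ENNReal.ofReal (w z * ‖v z‖ ^ 2) :=
  (hw.mul ((measurable_coe v).norm.pow_const 2)).ennreal_ofReal

theorem rho_coe (p : Poly) : ∀ᵐ z : S2 ∂sigma, rho p z = MvPolynomial.eval (coord z) p := by
  rw [rho_eq_toLp]
  filter_upwards [ContinuousMap.coeFn_toLp sigma (polyCont p) (p := 2) (𝕜 := ℂ)] with z hz
  rw [hz, polyCont_apply]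

/-- `tan² θ` on `S²`. -/
noncomputable def tanSq (z : S2) : ℝ := Real.tan (latitude z) ^ 2

theorem tanSq_nonneg (z : S2) : 0 ≤ tanSq z := sq_nonneg _

/-- At the poles both sides are `0` by the conventions for `tan` and division. -/
theorem tanSq_eq (z : S2) : tanSq z = (z : E3) 2 ^ 2 / (1 - (z : E3) 2 ^ 2) := by
  have h := sum_sq_eq_one z
  rw [tanSq, latitude, Real.tan_arcsin, div_pow, Real.sq_sqrt]
  nlinarith [sq_nonneg ((z : E3) 0), sq_nonneg ((z : E3) 1)]

theorem measurable_tanSq : Measurable tanSq := by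
  have h : Measurable fun z : S2 => (z : E3) 2 :=
    ((EuclideanSpace.proj (𝕜 := ℝ) (2 : Fin 3)).continuous.comp continuous_subtype_val).measurable
  rw [funext tanSq_eq]
  fun_prop

theorem div_mul_norm_sq_le {x y s : ℝ} {a b c : ℂ} (h1 : x ^ 2 + y ^ 2 + s ^ 2 = 1)
    (h2 : x * a + y * b + s * c = 0) :
    s ^ 2 / (1 - s ^ 2) * ‖c‖ ^ 2 ≤ ‖a‖ ^ 2 + ‖b‖ ^ 2 := by
  have hxy : 1 - s ^ 2 = x ^ 2 + y ^ 2 := by linarith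
  rw [hxy]
  rcases (by positivity : 0 ≤ x ^ 2 + y ^ 2).eq_or_lt with h | h
  · rw [← h, div_zero, zero_mul]; positivity
  have hc : s ^ 2 * ‖c‖ ^ 2 = ‖x * a + y * b‖ ^ 2 := by
    have : (s : ℂ) * c = -(x * a + y * b) := by linear_combination h2
    rw [← norm_neg (_ + _), ← this, norm_mul, mul_pow, Complex.norm_real, Real.norm_eq_abs, sq_abs]
  have hn : ‖x * a + y * b‖ ≤ |x| * ‖a‖ + |y| * ‖b‖ := by
    refine (norm_add_le _ _).trans_eq ?_
    simp
  rw [div_mul_eq_mul_div, div_le_iff₀ h, hc]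
  calc ‖x * a + y * b‖ ^ 2 ≤ (|x| * ‖a‖ + |y| * ‖b‖) ^ 2 := pow_le_pow_left₀ (norm_nonneg _) hn 2
    _ ≤ (‖a‖ ^ 2 + ‖b‖ ^ 2) * (|x| ^ 2 + |y| ^ 2) := by
      nlinarith [sq_nonneg (|x| * ‖b‖ - |y| * ‖a‖)]
    _ = _ := by rw [sq_abs, sq_abs]

/-- The vector `z₁Z₁ + z₂Z₂ + z₃Z₃` vanishes identically, being of the form `z · (z × ∇)` up to
sign. -/
theorem eval_zDer_relation (u : Poly) (z : E3) :
    (z 0 : ℂ) * MvPolynomial.eval (coord z) (zDer 0 u) +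
      (z 1 : ℂ) * MvPolynomial.eval (coord z) (zDer 1 u) +
      (z 2 : ℂ) * MvPolynomial.eval (coord z) (zDer 2 u) = 0 := by
  have h (j : Fin 3) : MvPolynomial.eval (coord z) (zDer j u) =
      fderiv ℝ (toTest u).toFun z (zField j z) := by
    rw [← toTest_apply, ← Z_toTest]; rfl
  simp only [h, ← Complex.real_smul, ← map_smul, ← map_add]
  convert map_zero (fderiv ℝ (toTest u).toFun z)
  ext i
  fin_cases i <;> simp [zField] <;> ring

theorem re_inner_polyL_self (u : Poly) : (inner ℂ (rho u) (rho (polyL u)) : ℂ).re =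
    ‖rho (zDer 0 u)‖ ^ 2 + ‖rho (zDer 1 u)‖ ^ 2 := by
  rw [rho_apply, rho_apply, ← grushin_toTest, inner_grushin_self, Z_toTest, Z_toTest,
    ← rho_apply, ← rho_apply, inner_self_eq_norm_sq_to_K, inner_self_eq_norm_sq_to_K]
  norm_cast

/-- The form inequality `tan² θ T² ≤ ℒ` on polynomials. -/
theorem wInt_polyT_le (u : Poly) :
    wInt tanSq (rho (polyT u)) ≤ ENNReal.ofReal (inner ℂ (rho u) (rho (polyL u))).re := by
  rw [re_inner_polyL_self, ENNReal.ofReal_add (by positivity) (by positivity), ← wInt_one, ← wInt_one]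
  unfold wInt
  rw [← lintegral_add_left (measurable_weight measurable_const _)]
  refine lintegral_mono_ae ?_
  filter_upwards [rho_coe (polyT u), rho_coe (zDer 0 u), rho_coe (zDer 1 u)] with z hT h0 h1
  rw [hT, h0, h1, ← ENNReal.ofReal_add (by positivity) (by positivity)]
  refine ENNReal.ofReal_le_ofReal ?_
  rw [one_mul, one_mul, tanSq_eq, polyT_apply, MvPolynomial.smul_eval, norm_mul, Complex.norm_I,
    one_mul]
  exact div_mul_norm_sq_le (sum_sq_eq_one z) (eval_zDer_relation u z)

/-! ### Interpolation to `0 < α < 1` -/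

/-- The function `t x / (x + t)`. -/
noncomputable def resK (t x : ℝ) : ℝ := t * x / (x + t)

theorem resK_mul_norm_add_sq_le {t x : ℝ} (ht : 0 < t) (hx : 0 ≤ x) (a b : ℂ) :
    resK t x * ‖a + b‖ ^ 2 ≤ x * ‖a‖ ^ 2 + t * ‖b‖ ^ 2 := by
  have h := pow_le_pow_left₀ (norm_nonneg _) (norm_add_le a b) 2
  have hxt : 0 < x + t := by positivity
  rw [resK, div_mul_eq_mul_div, div_le_iff₀ hxt]
  have h2 := mul_le_mul_of_nonneg_left h (mul_nonneg ht.le hx)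
  -- The square vanishes at the optimal splitting `x‖a‖ = t‖b‖`.
  nlinarith [sq_nonneg (x * ‖a‖ - t * ‖b‖)]

namespace IsJointFamily

variable {ι : Type} {p : ι → Poly} {lam m : ι → ℝ}

theorem lam_nonneg (hp : IsJointFamily p lam m) (i : ι) : 0 ≤ lam i := by
  have h := re_inner_polyL_self (p i)
  rw [hp.polyL_eq, inner_smul_right, inner_self_eq_norm_sq_to_K, hp.orthonormal.1] at h
  have h' : lam i = ‖rho (zDer 0 (p i))‖ ^ 2 + ‖rho (zDer 1 (p i))‖ ^ 2 := by simpa using h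
  rw [h']
  positivity

theorem div_nonneg (hp : IsJointFamily p lam m) (i : ι) : 0 ≤ lam i / m i ^ 2 :=
  _root_.div_nonneg (hp.lam_nonneg i) (sq_nonneg _)

variable [Fintype ι]

theorem norm_sum_sq (hp : IsJointFamily p lam m) (c : ι → ℂ) :
    ‖∑ i, c i • rho (p i)‖ ^ 2 = ∑ i, ‖c i‖ ^ 2 := by
  have h := hp.orthonormal.inner_sum c c Finset.univ
  rw [inner_self_eq_norm_sq_to_K] at h
  have h2 : ∑ i, (starRingEnd ℂ) (c i) * c i = ((∑ i, ‖c i‖ ^ 2 : ℝ) : ℂ) := by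
    rw [Complex.ofReal_sum]
    exact Finset.sum_congr rfl fun i _ => by rw [Complex.conj_mul']; norm_cast
  rw [h2] at h
  exact Complex.ofReal_injective ((Complex.ofReal_pow _ 2).trans h)

/-- Apply the form inequality to `T⁻¹v`, whose coefficients are `c i / m i`; the vanishing of `c` on
`ker T` makes it a preimage. -/
theorem wInt_tanSq_le (hp : IsJointFamily p lam m) (c : ι → ℂ) (hc : ∀ i, m i = 0 → c i = 0) :
    wInt tanSq (∑ i, c i • rho (p i)) ≤ ENNReal.ofReal (∑ i, lam i / m i ^ 2 * ‖c i‖ ^ 2) := by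
  have hT : rho (polyT (∑ i, (c i / m i) • p i)) = ∑ i, c i • rho (p i) := by
    simp only [map_sum, map_smul, hp.polyT_eq, smul_smul]
    refine Finset.sum_congr rfl fun i _ => ?_
    by_cases h : m i = 0
    · simp [hc i h]
    · rw [div_mul_cancel₀ _ (Complex.ofReal_ne_zero.2 h)]
  refine hT ▸ (wInt_polyT_le _).trans_eq ?_
  congr 1
  have hL : rho (polyL (∑ i, (c i / m i) • p i)) = ∑ i, (c i / m i * lam i) • rho (p i) := by
    simp only [map_sum, map_smul, hp.polyL_eq, smul_smul]
  rw [hL, map_sum]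
  simp only [map_smul]
  rw [hp.orthonormal.inner_sum, Complex.re_sum]
  refine Finset.sum_congr rfl fun i _ => ?_
  rw [← mul_assoc, Complex.conj_mul', ← Complex.ofReal_pow, ← Complex.ofReal_mul, Complex.ofReal_re,
    norm_div, Complex.norm_real, Real.norm_eq_abs, div_pow, sq_abs]
  ring

/-- Each `c i` is split optimally for the spectral weight `β i`, so the right side is attained
exactly; on the left any splitting gives an upper bound. -/
theorem wInt_resK_le (hp : IsJointFamily p lam m) (c : ι → ℂ) (hc : ∀ i, m i = 0 → c i = 0)
    {t : ℝ} (ht : 0 < t) :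
    wInt (fun z => resK t (tanSq z)) (∑ i, c i • rho (p i)) ≤
      ENNReal.ofReal (∑ i, resK t (lam i / m i ^ 2) * ‖c i‖ ^ 2) := by
  set β : ι → ℝ := fun i => lam i / m i ^ 2 with hβ
  have hβ0 (i) : 0 ≤ β i := hp.div_nonneg i
  have hβt (i) : 0 < β i + t := by have := hβ0 i; positivity
  set cg : ι → ℂ := fun i => ((t / (β i + t) : ℝ) : ℂ) * c i with hcg
  set ch : ι → ℂ := fun i => ((β i / (β i + t) : ℝ) : ℂ) * c i with hch
  have hsum : ∑ i, c i • rho (p i) = ∑ i, cg i • rho (p i) + ∑ i, ch i • rho (p i) := by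
    rw [← Finset.sum_add_distrib]
    refine Finset.sum_congr rfl fun i _ => ?_
    rw [← add_smul, hcg, hch]
    dsimp only
    rw [← add_mul, ← Complex.ofReal_add, ← add_div, add_comm t, div_self (hβt i).ne',
      Complex.ofReal_one, one_mul]
  have hg := hp.wInt_tanSq_le cg fun i hi => by simp [hcg, hc i hi]
  calc wInt (fun z => resK t (tanSq z)) (∑ i, c i • rho (p i))
      ≤ wInt tanSq (∑ i, cg i • rho (p i)) +
          ENNReal.ofReal t * wInt (fun _ => 1) (∑ i, ch i • rho (p i)) := by
        unfold wInt
        rw [← lintegral_const_mul' _ _ ENNReal.ofReal_ne_top, ← lintegral_add_left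
          (measurable_weight measurable_tanSq _), hsum]
        refine lintegral_mono_ae ?_
        filter_upwards [Lp.coeFn_add (∑ i, cg i • rho (p i)) (∑ i, ch i • rho (p i))] with z hz
        rw [hz, Pi.add_apply, ← ENNReal.ofReal_mul ht.le, ← ENNReal.ofReal_add
          (mul_nonneg (tanSq_nonneg z) (by positivity)) (by positivity), one_mul]
        exact ENNReal.ofReal_le_ofReal (resK_mul_norm_add_sq_le ht (tanSq_nonneg z) _ _)
    _ ≤ ENNReal.ofReal (∑ i, β i * ‖cg i‖ ^ 2) +
          ENNReal.ofReal t * ENNReal.ofReal (∑ i, ‖ch i‖ ^ 2) := by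
        rw [wInt_one, hp.norm_sum_sq]
        gcongr
    _ = ENNReal.ofReal (∑ i, resK t (β i) * ‖c i‖ ^ 2) := by
        rw [← ENNReal.ofReal_mul ht.le, ← ENNReal.ofReal_add
          (Finset.sum_nonneg fun i _ => mul_nonneg (hβ0 i) (by positivity)) (by positivity),
          Finset.mul_sum, ← Finset.sum_add_distrib]
        congr 1
        refine Finset.sum_congr rfl fun i _ => ?_
        have := (hβt i).ne'
        simp only [hcg, hch, norm_mul, Complex.norm_real, Real.norm_eq_abs, mul_pow, sq_abs, resK]
        field_simp
        ring

end IsJointFamily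

theorem rpowIntegrand_eq_resK (α : ℝ) {t x : ℝ} (ht : 0 < t) (hx : 0 ≤ x) :
    Real.rpowIntegrand₀₁ α t x = t ^ α / t ^ 2 * resK t x := by
  have h1 := ht.ne'
  have h2 : t + x ≠ 0 := by positivity
  have h3 : x + t ≠ 0 := by positivity
  rw [Real.rpowIntegrand₀₁, resK]
  field_simp
  ring

theorem lintegral_rpowIntegrand {α : ℝ} (hα : α ∈ Set.Ioo (0 : ℝ) 1) {x : ℝ} (hx : 0 ≤ x) :
    ∫⁻ t in Set.Ioi (0 : ℝ), ENNReal.ofReal (Real.rpowIntegrand₀₁ α t x) =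
      ENNReal.ofReal (∫ t in Set.Ioi (0 : ℝ), Real.rpowIntegrand₀₁ α t 1) *
        ENNReal.ofReal (x ^ α) := by
  rw [← ofReal_integral_eq_lintegral_ofReal (Real.integrableOn_rpowIntegrand₀₁_Ioi hα hx),
    Real.integral_rpowIntegrand₀₁_eq_rpow_mul_const hα hx, mul_comm,
    ENNReal.ofReal_mul (Real.integral_rpowIntegrand₀₁_one_pos hα).le]
  filter_upwards [ae_restrict_mem measurableSet_Ioi] with t ht
  exact Real.rpowIntegrand₀₁_nonneg hα.1 (le_of_lt ht) hx

theorem measurable_rpowIntegrand (α : ℝ) :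
    Measurable fun q : ℝ × ℝ => Real.rpowIntegrand₀₁ α q.1 q.2 := by
  unfold Real.rpowIntegrand₀₁
  fun_prop

/-- Integrate the inequality for `resK t` against the positive weight `t ^ α / t ^ 2`, with Tonelli
on the left; both sides acquire the same constant `C`, which is positive and finite. -/
theorem IsJointFamily.wInt_rpow_le_of_mem_Ioo {ι : Type} [Fintype ι] {p : ι → Poly} {lam m : ι → ℝ}
    (hp : IsJointFamily p lam m) (c : ι → ℂ) (hc : ∀ i, m i = 0 → c i = 0) {α : ℝ}
    (hα : α ∈ Set.Ioo (0 : ℝ) 1) :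
    wInt (fun z => tanSq z ^ α) (∑ i, c i • rho (p i)) ≤
      ENNReal.ofReal (∑ i, (lam i / m i ^ 2) ^ α * ‖c i‖ ^ 2) := by
  set v : L2 := ∑ i, c i • rho (p i) with hv
  set C : ℝ≥0∞ := ENNReal.ofReal (∫ t in Set.Ioi (0 : ℝ), Real.rpowIntegrand₀₁ α t 1) with hC
  have hC0 : C ≠ 0 := (ENNReal.ofReal_pos.2 (Real.integral_rpowIntegrand₀₁_one_pos hα)).ne'
  refine (ENNReal.mul_le_mul_iff_right hC0 ENNReal.ofReal_ne_top).1 ?_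
  have hmeas : Measurable fun q : S2 × ℝ =>
      ENNReal.ofReal (Real.rpowIntegrand₀₁ α q.2 (tanSq q.1) * ‖v q.1‖ ^ 2) := by
    have h1 := (measurable_rpowIntegrand α).comp
      (measurable_snd.prodMk (measurable_tanSq.comp measurable_fst) :
        Measurable fun q : S2 × ℝ => (q.2, tanSq q.1))
    exact (h1.mul (((measurable_coe v).comp measurable_fst).norm.pow_const 2)).ennreal_ofReal
  calc C * wInt (fun z => tanSq z ^ α) v
      = ∫⁻ z, (∫⁻ t in Set.Ioi (0 : ℝ),
          ENNReal.ofReal (Real.rpowIntegrand₀₁ α t (tanSq z) * ‖v z‖ ^ 2)) ∂sigma := by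
        rw [wInt, ← lintegral_const_mul' _ _ ENNReal.ofReal_ne_top]
        refine lintegral_congr fun z => ?_
        simp only [ENNReal.ofReal_mul' (sq_nonneg ‖v z‖)]
        rw [lintegral_mul_const' _ _ ENNReal.ofReal_ne_top,
          lintegral_rpowIntegrand hα (tanSq_nonneg z), mul_assoc]
    _ = ∫⁻ t in Set.Ioi (0 : ℝ), ∫⁻ z,
          ENNReal.ofReal (Real.rpowIntegrand₀₁ α t (tanSq z) * ‖v z‖ ^ 2) ∂sigma :=
        lintegral_lintegral_swap hmeas.aemeasurable
    _ ≤ ∫⁻ t in Set.Ioi (0 : ℝ),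
          ∑ i, ENNReal.ofReal (Real.rpowIntegrand₀₁ α t (lam i / m i ^ 2) * ‖c i‖ ^ 2) := by
        refine setLIntegral_mono' measurableSet_Ioi fun t ht => ?_
        have ht' : (0 : ℝ) < t := ht
        have hs : 0 ≤ t ^ α / t ^ 2 := by positivity
        have hnn (i) : 0 ≤ Real.rpowIntegrand₀₁ α t (lam i / m i ^ 2) * ‖c i‖ ^ 2 :=
          mul_nonneg (Real.rpowIntegrand₀₁_nonneg hα.1 ht'.le (hp.div_nonneg i)) (sq_nonneg _)
        rw [← ENNReal.ofReal_sum_of_nonneg fun i _ => hnn i]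
        simp only [rpowIntegrand_eq_resK α ht' (tanSq_nonneg _),
          rpowIntegrand_eq_resK α ht' (hp.div_nonneg _), mul_assoc, ENNReal.ofReal_mul hs,
          ← Finset.mul_sum]
        rw [lintegral_const_mul' _ _ ENNReal.ofReal_ne_top]
        exact mul_le_mul_right (hp.wInt_resK_le c hc ht') _
    _ = C * ENNReal.ofReal (∑ i, (lam i / m i ^ 2) ^ α * ‖c i‖ ^ 2) := by
        rw [lintegral_finsetSum' _ fun i _ => ?_, ENNReal.ofReal_sum_of_nonneg fun i _ =>
          mul_nonneg (Real.rpow_nonneg (hp.div_nonneg i) _) (sq_nonneg _), Finset.mul_sum]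
        · refine Finset.sum_congr rfl fun i _ => ?_
          simp only [ENNReal.ofReal_mul' (sq_nonneg ‖c i‖)]
          rw [lintegral_mul_const' _ _ ENNReal.ofReal_ne_top,
            lintegral_rpowIntegrand hα (hp.div_nonneg i), mul_assoc]
        · have h1 := (measurable_rpowIntegrand α).comp
            (measurable_id.prodMk measurable_const :
              Measurable fun t : ℝ => (t, lam i / m i ^ 2))
          exact (h1.mul_const _).ennreal_ofReal.aemeasurable

/-- The interpolated form inequality `(tan² θ)^α ≤ (ℒ / T²)^α` on finite joint families. -/
theorem IsJointFamily.wInt_rpow_le {ι : Type} [Fintype ι] {p : ι → Poly} {lam m : ι → ℝ}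
    (hp : IsJointFamily p lam m) (c : ι → ℂ) (hc : ∀ i, m i = 0 → c i = 0) {α : ℝ}
    (hα : α ∈ Set.Icc (0 : ℝ) 1) :
    wInt (fun z => tanSq z ^ α) (∑ i, c i • rho (p i)) ≤
      ENNReal.ofReal (∑ i, (lam i / m i ^ 2) ^ α * ‖c i‖ ^ 2) := by
  rcases hα.1.eq_or_lt with rfl | h0
  · simp only [Real.rpow_zero, one_mul, wInt_one, hp.norm_sum_sq, le_refl]
  rcases hα.2.eq_or_lt with rfl | h1
  · simpa only [Real.rpow_one] using hp.wInt_tanSq_le c hc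
  exact hp.wInt_rpow_le_of_mem_Ioo c hc ⟨h0, h1⟩

/-! ### Passage to the limit and conclusion -/

/-- Weighted integrals are lower semicontinuous on `L²(S²)`. -/
theorem wInt_le_of_tendsto {w : S2 → ℝ} (hw : Measurable w) {v : ℕ → L2} {f : L2} {B : ℝ≥0∞}
    (hv : Filter.Tendsto v Filter.atTop (nhds f)) (hB : ∀ k, wInt w (v k) ≤ B) :
    wInt w f ≤ B := by
  -- A subsequence converges almost everywhere, so Fatou's lemma applies.
  obtain ⟨ns, -, hns⟩ := (tendstoInMeasure_of_tendsto_Lp hv).exists_seq_tendsto_ae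
  calc wInt w f ≤ ∫⁻ z, Filter.liminf
        (fun k => ENNReal.ofReal (w z * ‖v (ns k) z‖ ^ 2)) Filter.atTop ∂sigma := by
        refine lintegral_mono_ae ?_
        filter_upwards [hns] with z hz
        exact (ENNReal.tendsto_ofReal ((hz.norm.pow 2).const_mul (w z))).liminf_eq.ge
    _ ≤ Filter.liminf (fun k => wInt w (v (ns k))) Filter.atTop :=
        lintegral_liminf_le fun k => measurable_weight hw _
    _ ≤ B := Filter.liminf_le_of_frequently_le' (.of_forall fun k => hB _)

/-- The coefficients of `ℒ^(α/2) |T|^(-α) f` along a joint family. -/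
theorem IsJointFamily.inner_pow {ι : Type} {p : ι → Poly} {lam m : ι → ℝ}
    (hp : IsJointFamily p lam m) {α : ℝ} {f : L2} (h : f ∈ (absTPow (-α)).domain)
    (hg : absTPow (-α) ⟨f, h⟩ ∈ (grushinPow (α / 2)).domain) (i : ι) :
    inner ℂ (rho (p i)) (grushinPow (α / 2) ⟨absTPow (-α) ⟨f, h⟩, hg⟩) =
      ((lam i ^ (α / 2) : ℝ) : ℂ) *
        (((|m i| ^ (-α) : ℝ) : ℂ) * inner ℂ (rho (p i)) f) := by
  have hL : IsEigenfun grushin (lam i) (toTest (p i)) := by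
    rw [IsEigenfun, grushin_toTest]; exact hp.polyL_eq i
  have hT : IsEigenfun opT (m i) (toTest (p i)) := by
    rw [IsEigenfun, opT_toTest]; exact hp.polyT_eq i
  exact (hL.inner_funCalc isSymm_grushin _ ⟨_, hg⟩).trans
    (congrArg _ (hT.inner_funCalc isSymm_opT _ ⟨f, h⟩))

theorem div_sq_rpow {l : ℝ} (hl : 0 ≤ l) {m : ℝ} (hm : m ≠ 0) (α : ℝ) :
    (l / m ^ 2) ^ α = (l ^ (α / 2)) ^ 2 * (|m| ^ (-α)) ^ 2 := by
  have hm' : 0 < |m| := abs_pos.2 hm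
  rw [Real.div_rpow hl (sq_nonneg _), ← sq_abs, ← Real.rpow_mul_natCast hl,
    ← Real.rpow_mul_natCast hm'.le, ← Real.rpow_natCast_mul hm'.le, div_eq_mul_inv,
    ← Real.rpow_neg hm'.le]
  congr 2 <;> push_cast <;> ring

/-- Bessel's inequality for `ℒ^(α/2)|T|^(-α)f`, whose squared coefficients are exactly the summands
on the left. -/
theorem IsJointFamily.sum_le {ι : Type} [Fintype ι] {p : ι → Poly} {lam m : ι → ℝ}
    (hp : IsJointFamily p lam m) {α : ℝ} {f : L2}
    (hc : ∀ i, m i = 0 → inner ℂ (rho (p i)) f = 0) (h : f ∈ (absTPow (-α)).domain)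
    (hg : absTPow (-α) ⟨f, h⟩ ∈ (grushinPow (α / 2)).domain) :
    ∑ i, (lam i / m i ^ 2) ^ α * ‖(inner ℂ (rho (p i)) f : ℂ)‖ ^ 2 ≤
      ‖grushinPow (α / 2) ⟨absTPow (-α) ⟨f, h⟩, hg⟩‖ ^ 2 := by
  refine le_trans (Finset.sum_le_sum fun i _ => ?_) (hp.orthonormal.sum_inner_products_le _)
  rw [hp.inner_pow h hg]
  by_cases hm : m i = 0
  · rw [hc i hm]; simp
  rw [norm_mul, norm_mul, mul_pow, mul_pow, Complex.norm_real, Complex.norm_real,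
    Real.norm_of_nonneg (Real.rpow_nonneg (hp.lam_nonneg i) _),
    Real.norm_of_nonneg (Real.rpow_nonneg (abs_nonneg _) _), ← mul_assoc,
    div_sq_rpow (hp.lam_nonneg i) hm]

theorem wInt_rpow_le_extNorm {f : L2} (hf : ∀ l : ℕ, inner ℂ (zonal l) f = 0) {α : ℝ}
    (hα : α ∈ Set.Icc (0 : ℝ) 1) (h : f ∈ (absTPow (-α)).domain) :
    wInt (fun z => tanSq z ^ α) f ≤ extNorm (grushinPow (α / 2)) (absTPow (-α) ⟨f, h⟩) ^ 2 := by
  rw [extNorm]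
  split_ifs with hg
  swap
  · simp
  have happrox (k : ℕ) : ∃ v : L2, ‖f - v‖ < 1 / ((k : ℝ) + 1) ∧
      wInt (fun z => tanSq z ^ α) v ≤
        ‖grushinPow (α / 2) ⟨absTPow (-α) ⟨f, h⟩, hg⟩‖ₑ ^ 2 := by
    obtain ⟨ι, _, p, lam, m, hp, hlt⟩ :=
      exists_jointFamily_approx f (Nat.one_div_pos_of_nat (α := ℝ) (n := k))
    -- The only use of the zonal hypothesis: `f` has no component along joint eigenfunctions in `ker
    -- T`.
    have hc (i) (hi : m i = 0) : inner ℂ (rho (p i)) f = 0 :=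
      inner_rho_eq_zero_of_polyT hf (by rw [hp.polyT_eq, hi, Complex.ofReal_zero, zero_smul])
    refine ⟨_, hlt, (hp.wInt_rpow_le _ hc hα).trans ?_⟩
    rw [← ofReal_norm, ← ENNReal.ofReal_pow (norm_nonneg _)]
    exact ENNReal.ofReal_le_ofReal (hp.sum_le hc h hg)
  choose v hv hB using happrox
  refine wInt_le_of_tendsto (measurable_tanSq.pow_const α) ?_ hB
  rw [tendsto_iff_norm_sub_tendsto_zero]
  refine squeeze_zero (fun _ => norm_nonneg _) (fun k => ?_)
    tendsto_one_div_add_atTop_nhds_zero_nat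
  rw [norm_sub_rev]
  exact (hv k).le

end GrushinSphere

theorem mainTheorem10 (f : GrushinSphere.L2)
    (hf : ∀ l : ℕ, inner ℂ (GrushinSphere.zonal l) f = 0)
    (α : ℝ) (hα : α ∈ Set.Icc (0 : ℝ) 1) :
    ∃ h : f ∈ (GrushinSphere.absTPow (-α)).domain,
      ∫⁻ z, ENNReal.ofReal
          (|Real.tan (GrushinSphere.latitude z)| ^ (2 * α) * ‖f z‖ ^ 2) ∂GrushinSphere.sigma
        ≤ GrushinSphere.extNorm (GrushinSphere.grushinPow (α / 2))
            (GrushinSphere.absTPow (-α) ⟨f, h⟩) ^ 2 := by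
  have h := GrushinSphere.mem_domain_absTPow hα.1 f
  refine ⟨h, le_of_eq_of_le (lintegral_congr fun z => ?_)
    (GrushinSphere.wInt_rpow_le_extNorm hf hα h)⟩
  have hz : |Real.tan (GrushinSphere.latitude z)| ^ (2 * α) = GrushinSphere.tanSq z ^ α := by
    rw [GrushinSphere.tanSq, ← sq_abs, ← Real.rpow_natCast_mul (abs_nonneg _), Nat.cast_ofNat]
  rw [hz]
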